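/- **Setting.** Let $L$ be an even, non-degenerate integral lattice of signature $(b^+,b^-)$ with bilinear form $(\cdot,\cdot)$, $q(x)=\tfrac12(x,x)$, dual lattice $L'=\{x\in L\otimes\mathbb{Q} : (x,y)\in\mathbb{Z}\ \forall y\in L\}$ and finite discriminant group $A=L'/L$. Write $\boldsymbol{e}(x)=\exp(2\pi i x)$. Let $\mathrm{Mp}_2(\mathbb{Z})$ be the group of pairs $(M,\phi)$ with $M=\begin{pmatrix}a&b\\c&d\end{pmatrix}\in\mathrm{SL}_2(\mathbb{Z})$ and $\phi$ holomorphic on the upper half-plane $\mathbb{H}$ with $\phi(\tau)^2=c\tau+d$, with product $(M_1,\phi_1)(M_2,\phi_2)=(M_1M_2,\phi_1(M_2\tau)\phi_2(\tau))$; it is generated by $T=\left(\begin{pmatrix}1&1\\0&1\end{pmatrix},1\right)$ and $S=\left(\begin{pmatrix}0&-1\\1&0\end{pmatrix},\sqrt\tau\right)$. The Weil representation $\rho_L$ of $\mathrm{Mp}_2(\mathbb{Z})$ on $\mathbb{C}[A]=\bigoplus_{\lambda\in A}\mathbb{C}e_\lambda$ is the representation with $$\rho_L(T)e_\lambda=\boldsymbol{e}(q(\lambda))e_\lambda,\qquad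 \rho_L(S)e_\lambda=\frac{\boldsymbol{e}(-(b^+-b^-)/8)}{\sqrt{|A|}}\sum_{\mu\in A}\boldsymbol{e}(-(\lambda,\mu))e_\mu .$$ Let $W$ be a real vector space (for instance $L\otimes\mathbb{R}$) and $v,\bar v\in\tfrac12\mathbb{Z}$. For a representation $\rho$ on a finite-dimensional complex space $U$, let $M_{v,\bar v,\rho}$ be the space of real analytic functions $\psi:\mathbb{H}\times W\times W\to U$ with $$\psi(M\tau,a\alpha+b\beta,c\alpha+d\beta)=\phi(\tau)^{2v}\,\overline{\phi(\tau)}^{\,2\bar v}\,\rho(M,\phi)\,\psi(\tau,\alpha,\beta)\quad\text{for all }(M,\phi)\in\mathrm{Mp}_2(\mathbb{Z});$$ its elements are called vector-valued modular of weight $(v,\bar v)$ and type $\rho$. Functions $\psi(\tau)$ of $\tau$ alone are the case without the variables $\alpha,\beta$ ($W=0$). For a positive integer $r$ let $L(r)$ be $L$ with the form $(\cdot,\cdot)_r=r(\cdot,\cdot)$, $q_r=rq$, and $A(r)=L(r)'/L(r)$, where $L(r)'=\frac1rL'$. For $kl=r$ and $\mu\in A(r)$ let $\Delta_r(\mu,k)=1$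 if $\mu\in A(l)\subseteq A(r)$, and $0$ otherwise. Put $(w,\bar w)=(v+\tfrac{b^+}{2},\bar v+\tfrac{b^-}{2})$. For $\psi=\sum_{\lambda\in A}\psi_\lambda e_\lambda$ of weight $(v,\bar v)$ define $$\mathcal{T}_r[\psi](\tau)=r^{w+\bar w-1}\sum_{\mu\in A(r)}\Bigg(\sum_{\substack{k,l>0\\kl=r}}\frac1{l^{w+\bar w}}\sum_{s=0}^{l-1}\Delta_r(\mu,k)\,\boldsymbol{e}\Big(-\frac sk q_r(\mu)\Big)\psi_{l\mu}\Big(\frac{k\tau+s}{l}\Big)\Bigg)e_\mu ,$$ where, if $\psi$ also depends on $(\alpha,\beta)$, the argument $\frac{k\tau+s}{l}$ is replaced by $\big(\frac{k\tau+s}{l},k\alpha+s\beta,l\beta\big)$. **Corollary.** For every positive integer $r$ and all $v,\bar v\in\tfrac12\mathbb{Z}$: 1. If $\psi(\tau)$ is vector-valued modular of weight $(v,\bar v)$ and type $\rho_L$, then $\mathcal{T}_r[\psi](\tau)$ is vector-valued modular of the same weight $(v,\bar v)$ and type $\rho_{L(r)}$. The same holds for functions $\psi(\tau,\alpha,\beta)$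 on $\mathbb{H}\times W\times W$. In other words, $\mathcal{T}_r$ maps $M_{v,\bar v,\rho_L}$ to $M_{v,\bar v,\rho_{L(r)}}$. 2. In particular, suppose that $L$ has rank $\ell$ and signature $(1,\ell-1)$, and that $\psi(\tau)$ is vector-valued modular of weight $(-1-\tfrac{\ell}{2},0)$ and type $\rho_L$. Then the functions (which, for the appropriate $\psi$, are the generating functions of vertical D4-D2-D0 bound states on K3-fibered Calabi–Yau threefolds) $$Z_{r,\delta}(\tau)=r^{-2}\sum_{\substack{k,l>0\\kl=r}}l\sum_{s=0}^{l-1}\Delta_r(\delta,k)\,\boldsymbol{e}\Big(-\frac sk q_r(\delta)\Big)\psi_{l\delta}\Big(\frac{k\tau+s}{l}\Big),\qquad\delta\in A(r),$$ are the components of a function $\sum_{\delta\in A(r)}Z_{r,\delta}e_\delta$ that is vector-valued modular of weight $(-1-\tfrac{\ell}{2},0)$ and type $\rho_{L(r)}$. -/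

import Mathlib

open scoped MatrixGroups Manifold ComplexConjugate

noncomputable section

namespace VVHecke

open UpperHalfPlane

/-! ### The metaplectic group `Mp₂(ℤ)` -/

/-- The automorphy factor `c τ + d` of `M = (a b; c d) ∈ SL₂(ℤ)`. -/
def autFactor (M : SL(2, ℤ)) (τ : ℍ) : ℂ := ((M 1 0 : ℤ) : ℂ) * (τ : ℂ) + ((M 1 1 : ℤ) : ℂ)

theorem autFactor_ne_zero (M : SL(2, ℤ)) (τ : ℍ) : autFactor M τ ≠ 0 := by
  have h := UpperHalfPlane.denom_ne_zero (M : GL (Fin 2) ℝ) τ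
  rwa [ModularGroup.denom_apply] at h

theorem autFactor_mul (M N : SL(2, ℤ)) (τ : ℍ) :
    autFactor (M * N) τ = autFactor M (N • τ) * autFactor N τ := by
  have hN : ((N 1 0 : ℤ) : ℂ) * (τ : ℂ) + ((N 1 1 : ℤ) : ℂ) ≠ 0 := autFactor_ne_zero N τ
  simp only [autFactor, UpperHalfPlane.coe_specialLinearGroup_apply,
    Matrix.SpecialLinearGroup.coe_mul, Matrix.mul_apply, Fin.sum_univ_two]
  simp only [eq_intCast, Complex.ofReal_intCast]
  rw [add_mul, mul_assoc, div_mul_cancel₀ _ hN]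
  push_cast
  ring

/-- The metaplectic group: pairs `(M, φ)` with `M ∈ SL₂(ℤ)` and `φ` a holomorphic function
on the upper half-plane with `φ(τ)² = c τ + d`. -/
@[ext]
structure Mp2Z where
  mat : SL(2, ℤ)
  phi : ℍ → ℂ
  holo : MDifferentiable 𝓘(ℂ) 𝓘(ℂ) phi
  sq : ∀ τ, phi τ ^ 2 = autFactor mat τ

namespace Mp2Z

theorem phi_ne_zero (g : Mp2Z) (τ : ℍ) : g.phi τ ≠ 0 := by
  intro h
  have h2 := g.sq τ
  rw [h] at h2
  exact autFactor_ne_zero g.mat τ (by rw [← h2]; norm_num)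

theorem mdifferentiable_SL_smul (M : SL(2, ℤ)) :
    MDifferentiable 𝓘(ℂ) 𝓘(ℂ) (fun τ : ℍ => M • τ) :=
  UpperHalfPlane.mdifferentiable_smul (g := (M : GL (Fin 2) ℝ)) (by simp)

/-- `(M₁, φ₁) (M₂, φ₂) = (M₁ M₂, φ₁(M₂ τ) φ₂(τ))`. -/
instance : Mul Mp2Z where
  mul g h :=
    { mat := g.mat * h.mat
      phi := fun τ => g.phi (h.mat • τ) * h.phi τ
      holo := (g.holo.comp (mdifferentiable_SL_smul h.mat)).mul h.holo
      sq := fun τ => by rw [mul_pow, g.sq, h.sq, autFactor_mul] }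

instance : One Mp2Z where
  one :=
    { mat := 1
      phi := fun _ => 1
      holo := mdifferentiable_const
      sq := fun τ => by simp [autFactor] }

/-- `(M, φ)⁻¹ = (M⁻¹, 1 / φ(M⁻¹ τ))`. -/
instance : Inv Mp2Z where
  inv g :=
    { mat := g.mat⁻¹
      phi := fun τ => (g.phi (g.mat⁻¹ • τ))⁻¹
      holo := by
        have h := g.holo.comp (mdifferentiable_SL_smul g.mat⁻¹)
        rw [UpperHalfPlane.mdifferentiable_iff] at h ⊢
        exact h.inv fun z _ => g.phi_ne_zero _
      sq := fun τ => by
        have h := autFactor_mul g.mat g.mat⁻¹ τ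
        rw [mul_inv_cancel, ← g.sq] at h
        have h1 : autFactor 1 τ = 1 := by simp [autFactor]
        rw [h1] at h
        rw [inv_pow]
        exact inv_eq_of_mul_eq_one_right h.symm }

@[simp] theorem mul_mat (g h : Mp2Z) : (g * h).mat = g.mat * h.mat := rfl
@[simp] theorem mul_phi (g h : Mp2Z) (τ : ℍ) :
    (g * h).phi τ = g.phi (h.mat • τ) * h.phi τ := rfl
@[simp] theorem one_mat : (1 : Mp2Z).mat = 1 := rfl
@[simp] theorem one_phi (τ : ℍ) : (1 : Mp2Z).phi τ = 1 := rfl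
@[simp] theorem inv_mat (g : Mp2Z) : (g⁻¹).mat = g.mat⁻¹ := rfl
@[simp] theorem inv_phi (g : Mp2Z) (τ : ℍ) : (g⁻¹).phi τ = (g.phi (g.mat⁻¹ • τ))⁻¹ := rfl

instance : Group Mp2Z :=
  Group.ofLeftAxioms
    (fun a b c => Mp2Z.ext (mul_assoc _ _ _) (by
      funext τ
      simp [mul_assoc, SemigroupAction.mul_smul]))
    (fun a => Mp2Z.ext (one_mul _) (by funext τ; simp))
    (fun a => Mp2Z.ext (inv_mul_cancel _) (by
      funext τ
      simp [inv_mul_cancel₀ (a.phi_ne_zero τ)]))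

/-- The generator `T = ((1 1; 0 1), 1)`. -/
def T : Mp2Z where
  mat := ModularGroup.T
  phi := fun _ => 1
  holo := mdifferentiable_const
  sq := fun τ => by simp [autFactor, ModularGroup.T]

/-- The generator `S = ((0 -1; 1 0), √τ)`, with the principal branch of the square root. -/
def S : Mp2Z where
  mat := ModularGroup.S
  phi := fun τ => (τ : ℂ) ^ (1 / 2 : ℂ)
  holo := by
    rw [UpperHalfPlane.mdifferentiable_iff]
    have h : DifferentiableOn ℂ (fun z : ℂ => z ^ (1 / 2 : ℂ)) {z | 0 < z.im} := fun z hz =>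
      ((differentiableAt_id).cpow (differentiableAt_const _)
        (Complex.mem_slitPlane_iff.2 (Or.inr (ne_of_gt hz)))).differentiableWithinAt
    exact h.congr fun z hz => by simp [UpperHalfPlane.ofComplex_apply_of_im_pos hz]
  sq := fun τ => by
    have h : ((τ : ℂ) ^ (1 / 2 : ℂ)) ^ 2 = (τ : ℂ) := by
      rw [← Complex.cpow_nat_mul]; norm_num
    rw [h]
    simp [autFactor, ModularGroup.S]

end Mp2Z

/-! ### Functions that are vector-valued modular -/

section Modular

variable {ι : Type*} [Fintype ι] {W : Type*} [NormedAddCommGroup W] [NormedSpace ℝ W]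

/-- Real analyticity of a function on `ℍ × W × W`. -/
def IsRealAnalytic (ψ : ℍ × W × W → ι → ℂ) : Prop :=
  AnalyticOnNhd ℝ (fun p : ℂ × W × W => ψ (UpperHalfPlane.ofComplex p.1, p.2))
    {p | 0 < p.1.im}

/-- The action `(τ, α, β) ↦ (M τ, a α + b β, c α + d β)`. -/
def jacobiAct (M : SL(2, ℤ)) (p : ℍ × W × W) : ℍ × W × W :=
  (M • p.1, (M 0 0 : ℤ) • p.2.1 + (M 0 1 : ℤ) • p.2.2,
    (M 1 0 : ℤ) • p.2.1 + (M 1 1 : ℤ) • p.2.2)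

/-- `ψ` is a real analytic function on `ℍ × W × W` that is vector-valued modular of weight
`(m / 2, n / 2)` and type `ρ`. The half-integral weight `(v, v̄)` is recorded by the pair of
integers `(m, n) = (2 v, 2 v̄)`. -/
structure IsVVModular (ρ : Representation ℂ Mp2Z (ι → ℂ)) (m n : ℤ)
    (ψ : ℍ × W × W → ι → ℂ) : Prop where
  analytic : IsRealAnalytic ψ
  transform : ∀ (g : Mp2Z) (p : ℍ × W × W),
    ψ (jacobiAct g.mat p) = (g.phi p.1 ^ m * conj (g.phi p.1) ^ n) • ρ g (ψ p)

variable (W) in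
/-- The space `M_{v, v̄, ρ}` with `(v, v̄) = (m / 2, n / 2)`. -/
def modularSpace (ρ : Representation ℂ Mp2Z (ι → ℂ)) (m n : ℤ) :
    Submodule ℂ (ℍ × W × W → ι → ℂ) where
  carrier := {ψ | IsVVModular ρ m n ψ}
  zero_mem' := ⟨analyticOnNhd_const, fun g p => by simp⟩
  add_mem' {f g} hf hg := ⟨AnalyticOnNhd.add hf.analytic hg.analytic, fun γ p => by
    simp [hf.transform γ p, hg.transform γ p]⟩
  smul_mem' c f hf := ⟨AnalyticOnNhd.const_smul hf.analytic, fun γ p => by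
    simp only [Pi.smul_apply, hf.transform γ p, map_smul]
    rw [smul_comm]⟩

/-- The subspace of functions `ψ(τ)` of `τ` alone (no variables `α, β`, i.e. `W = 0`). -/
def modularSpaceTau (ρ : Representation ℂ Mp2Z (ι → ℂ)) (m n : ℤ) :
    Submodule ℂ (ℍ → ι → ℂ) :=
  (modularSpace PUnit.{1} ρ m n).comap (LinearMap.funLeft ℂ (ι → ℂ) Prod.fst)

end Modular

/-! ### Even lattices, discriminant forms and the Weil representation -/

/-- An even non-degenerate integral lattice of signature `(bPos, bNeg)`, realised in the
rational quadratic space `V = L ⊗ ℚ`. -/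
structure EvenLattice (V : Type*) [AddCommGroup V] [Module ℚ V] where
  form : LinearMap.BilinForm ℚ V
  carrier : Submodule ℤ V
  fg : carrier.FG
  span_eq_top : Submodule.span ℚ (carrier : Set V) = ⊤
  symm : ∀ x y, form x y = form y x
  nondegenerate : form.Nondegenerate
  integral : ∀ x ∈ carrier, ∀ y ∈ carrier, ∃ n : ℤ, form x y = n
  even : ∀ x ∈ carrier, ∃ n : ℤ, form x x = 2 * n
  bPos : ℕ
  bNeg : ℕ
  signature : ∃ b : Module.Basis (Fin bPos ⊕ Fin bNeg) ℚ V,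
    (∀ i j, i ≠ j → form (b i) (b j) = 0) ∧
    (∀ i, 0 < form (b (Sum.inl i)) (b (Sum.inl i))) ∧
    (∀ i, form (b (Sum.inr i)) (b (Sum.inr i)) < 0)

/-- `𝒆(x) = exp(2 π i x)`. -/
def e (x : ℚ) : ℂ := Complex.exp (2 * Real.pi * Complex.I * (x : ℂ))

theorem e_add (x y : ℚ) : e (x + y) = e x * e y := by
  simp only [e, ← Complex.exp_add]
  push_cast
  ring_nf

theorem e_int (n : ℤ) : e n = 1 := by
  rw [e, Complex.exp_eq_one_iff]
  exact ⟨n, by push_cast; ring⟩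

theorem e_add_int (x : ℚ) (n : ℤ) : e (x + n) = e x := by rw [e_add, e_int, mul_one]

namespace EvenLattice

variable {V : Type*} [AddCommGroup V] [Module ℚ V] (L : EvenLattice V)

/-- For a positive integer `l`, the dual lattice
`L(l)' = {x ∈ L ⊗ ℚ | l (x, y) ∈ ℤ for all y ∈ L}` of the rescaled lattice `L(l)`. -/
def scaledDual (l : ℕ) : Submodule ℤ V := ((l : ℚ) • L.form).dualSubmodule L.carrier

/-- The dual lattice `L' = {x ∈ L ⊗ ℚ | (x, y) ∈ ℤ for all y ∈ L}`. -/
def dual : Submodule ℤ V := L.form.dualSubmodule L.carrier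

theorem mem_dual {x : V} : x ∈ L.dual ↔ ∀ y ∈ L.carrier, ∃ n : ℤ, L.form x y = n := by
  simp only [dual, LinearMap.BilinForm.mem_dualSubmodule, Submodule.mem_one, eq_intCast, eq_comm]

theorem mem_scaledDual {l : ℕ} {x : V} :
    x ∈ L.scaledDual l ↔ ∀ y ∈ L.carrier, ∃ n : ℤ, l * L.form x y = n := by
  simp only [scaledDual, LinearMap.BilinForm.mem_dualSubmodule, Submodule.mem_one, eq_intCast,
    eq_comm, LinearMap.smul_apply, smul_eq_mul]

/-- The rescaled lattice `L(r)`: the same lattice with the form `(·,·)_r = r (·,·)`. -/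
def rescale (r : ℕ+) : EvenLattice V where
  form := ((r : ℕ) : ℚ) • L.form
  carrier := L.carrier
  fg := L.fg
  span_eq_top := L.span_eq_top
  symm x y := by simp [L.symm x y]
  nondegenerate := by
    have hr : (((r : ℕ) : ℚ)) ≠ 0 := by exact_mod_cast r.ne_zero
    refine ⟨fun x hx => L.nondegenerate.1 x fun y => ?_,
      fun y hy => L.nondegenerate.2 y fun x => ?_⟩
    · have := hx y
      simpa [hr] using this
    · have := hy x
      simpa [hr] using this
  integral x hx y hy := by
    obtain ⟨n, hn⟩ := L.integral x hx y hy
    exact ⟨r * n, by simp [hn]⟩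
  even x hx := by
    obtain ⟨n, hn⟩ := L.even x hx
    exact ⟨r * n, by simp [hn]; ring⟩
  bPos := L.bPos
  bNeg := L.bNeg
  signature := by
    have hr : 0 < (((r : ℕ) : ℚ)) := by exact_mod_cast r.pos
    obtain ⟨b, h0, h1, h2⟩ := L.signature
    exact ⟨b, fun i j hij => by simp [h0 i j hij], fun i => by simpa [hr] using h1 i,
      fun i => by simpa [hr] using mul_neg_of_pos_of_neg hr (h2 i)⟩

theorem carrier_le_dual : L.carrier ≤ L.dual := fun x hx =>
  L.mem_dual.2 fun y hy => L.integral x hx y hy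

/-- The discriminant group `A = L' / L`. -/
abbrev Disc : Type _ := L.dual ⧸ L.carrier.submoduleOf L.dual

theorem exists_smul_mem (x : V) : ∃ n : ℕ, n ≠ 0 ∧ n • x ∈ L.carrier := by
  have hx : x ∈ Submodule.span ℚ (L.carrier : Set V) := by rw [L.span_eq_top]; trivial
  induction hx using Submodule.span_induction with
  | mem x h => exact ⟨1, one_ne_zero, by simpa using h⟩
  | zero => exact ⟨1, one_ne_zero, by simp⟩
  | add x y _ _ hx hy =>
    obtain ⟨m, hm, hx⟩ := hx
    obtain ⟨n, hn, hy⟩ := hy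
    refine ⟨m * n, mul_ne_zero hm hn, ?_⟩
    rw [smul_add]
    refine add_mem ?_ ?_
    · rw [mul_comm, mul_smul]; exact nsmul_mem hx n
    · rw [mul_smul]; exact nsmul_mem hy m
  | smul a x _ hx =>
    obtain ⟨m, hm, hx⟩ := hx
    refine ⟨a.den * m, mul_ne_zero a.den_ne_zero hm, ?_⟩
    have h : (a.den * m) • a • x = a.num • (m • x) := by
      rw [← Nat.cast_smul_eq_nsmul ℚ, ← Nat.cast_smul_eq_nsmul ℚ, ← Int.cast_smul_eq_zsmul ℚ,
        smul_smul, smul_smul]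
      congr 1
      have := Rat.den_mul_eq_num a
      push_cast
      rw [← this]; ring
    rw [h]
    exact L.carrier.smul_mem _ hx

instance finite_dual : Module.Finite ℤ L.dual := by
  have : Module.Finite ℤ L.carrier := Module.Finite.iff_fg.2 L.fg
  have : Module.IsTorsionFree ℤ V := Module.IsTorsionFree.trans_faithfulSMul ℤ ℚ V
  have : Module.Free ℤ L.carrier := inferInstance
  exact Module.Finite.of_injective (L.form.dualSubmoduleToDual L.carrier)
    (L.form.dualSubmoduleToDual_injective L.nondegenerate L.carrier L.span_eq_top)

instance finite_disc : Finite L.Disc := by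
  apply Module.finite_of_fg_torsion
  intro a
  obtain ⟨x, rfl⟩ := Submodule.Quotient.mk_surjective _ a
  obtain ⟨n, hn, hx⟩ := L.exists_smul_mem (x : V)
  refine ⟨⟨(n : ℤ), mem_nonZeroDivisors_of_ne_zero (by exact_mod_cast hn)⟩, ?_⟩
  rw [Submonoid.smul_def, ← Submodule.Quotient.mk_smul, Submodule.Quotient.mk_eq_zero]
  simpa [Submodule.submoduleOf] using hx

instance fintype_disc : Fintype L.Disc := Fintype.ofFinite _

instance decidableEq_disc : DecidableEq L.Disc := Classical.decEq _

/-- The class in `A` of an element of `L'`. -/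
abbrev toDisc (x : L.dual) : L.Disc := Submodule.Quotient.mk x

/-- The quadratic form `q(x) = (x, x) / 2`. -/
def q (x : V) : ℚ := L.form x x / 2

theorem q_add (x y : V) : L.q (x + y) = L.q x + L.form x y + L.q y := by
  simp only [q, map_add, LinearMap.add_apply, L.symm y x]
  ring

/-- `𝒆(q(λ))` for `λ ∈ A`. -/
def eQ (a : L.Disc) : ℂ :=
  Quotient.liftOn' a (fun x => e (L.q x)) (by
    intro x y hxy
    rw [Submodule.quotientRel_def] at hxy
    have h : (x : V) - y ∈ L.carrier := by simpa [Submodule.submoduleOf] using hxy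
    obtain ⟨m, hm⟩ := L.mem_dual.1 y.2 _ h
    obtain ⟨n, hn⟩ := L.even _ h
    have h2 : L.q x = L.q y + ((m + n : ℤ) : ℚ) := by
      have := L.q_add y (x - y)
      rw [add_sub_cancel, hm] at this
      rw [this, q, q, hn]
      push_cast; ring
    change e (L.q x) = e (L.q y)
    rw [h2, e_add_int])

/-- `𝒆(-(λ, μ))` for `λ, μ ∈ A`. -/
def ePair (a b : L.Disc) : ℂ :=
  Quotient.liftOn₂' a b (fun x y => e (-L.form x y)) (by
    intro x y x' y' hx hy
    rw [Submodule.quotientRel_def] at hx hy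
    have h : (x : V) - x' ∈ L.carrier := by simpa [Submodule.submoduleOf] using hx
    have h' : (y : V) - y' ∈ L.carrier := by simpa [Submodule.submoduleOf] using hy
    obtain ⟨m, hm⟩ := L.mem_dual.1 y.2 _ h
    obtain ⟨n, hn⟩ := L.mem_dual.1 x'.2 _ h'
    have h2 : -L.form x y = -L.form x' y' + ((-m - n : ℤ) : ℚ) := by
      rw [L.symm] at hm
      push_cast
      rw [← hm, ← hn]
      simp only [map_sub, LinearMap.sub_apply]
      ring
    change e (-L.form x y) = e (-L.form x' y')
    rw [h2, e_add_int])

/-- The standard basis vector `e_λ` of `ℂ[A]`. -/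
abbrev basisVec (a : L.Disc) : L.Disc → ℂ := Pi.single a 1

/-- A representation `ρ` of `Mp₂(ℤ)` on `ℂ[A]` takes the values on the generators `T` and `S`
that define the Weil representation:
`ρ(T) e_λ = 𝒆(q(λ)) e_λ` and
`ρ(S) e_λ = 𝒆(-sgn(L) / 8) / √|A| * ∑_μ 𝒆(-(λ, μ)) e_μ`. -/
structure IsWeilRep (ρ : Representation ℂ Mp2Z (L.Disc → ℂ)) : Prop where
  onT : ∀ a, ρ Mp2Z.T (L.basisVec a) = L.eQ a • L.basisVec a
  onS : ∀ a, ρ Mp2Z.S (L.basisVec a) =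
    (e (-((L.bPos : ℚ) - L.bNeg) / 8) / (Real.sqrt (Fintype.card L.Disc) : ℂ)) •
      ∑ b, L.ePair a b • L.basisVec b

open Classical in
/-- The Weil representation `ρ_L`: the representation of `Mp₂(ℤ)` on `ℂ[A]` with the prescribed
values on `T` and `S`. It is unique because `T` and `S` generate `Mp₂(ℤ)`; that it exists is the
classical theorem of Weil, so that the second branch never occurs. -/
def weilRep : Representation ℂ Mp2Z (L.Disc → ℂ) :=
  if h : ∃ ρ, L.IsWeilRep ρ then h.choose else 1

/-! ### The Hecke operators -/

variable {L}

/-- If `μ ∈ A(l)` is the class of `x ∈ L(l)'`, then `l x ∈ L'`. -/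
theorem smul_mem_dual {l : ℕ} {x : V} (hx : x ∈ L.scaledDual l) : l • x ∈ L.dual := by
  rw [mem_scaledDual] at hx
  rw [mem_dual]
  intro y hy
  obtain ⟨n, hn⟩ := hx y hy
  exact ⟨n, by rw [← hn]; simp⟩

variable (L) in
open Classical in
/-- For `μ` the class of `x`, the number `Δ_r(μ, k) 𝒆(-(s / k) q_r(μ)) ψ_{l μ}`,
where `k l = r` and `Δ_r(μ, k) = 1` if `μ ∈ A(l)` and `0` otherwise. -/
def heckeTerm (r : ℕ+) (k l s : ℕ) (ψ : L.Disc → ℂ) (x : V) : ℂ :=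
  if h : x ∈ L.scaledDual l then
    e (-((s : ℚ) / k * (L.rescale r).q x)) * ψ (L.toDisc ⟨l • x, smul_mem_dual h⟩)
  else 0

theorem heckeTerm_congr (r : ℕ+) (k l s : ℕ) (hkl : k * l = r) (ψ : L.Disc → ℂ) (x y : V)
    (hxy : x - y ∈ L.carrier) : L.heckeTerm r k l s ψ x = L.heckeTerm r k l s ψ y := by
  have hsub : L.carrier ≤ L.scaledDual l := fun z hz => L.mem_scaledDual.2 fun w hw => by
    obtain ⟨n, hn⟩ := L.integral z hz w hw
    exact ⟨l * n, by rw [hn]; push_cast; ring⟩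
  have hk : (k : ℚ) ≠ 0 := by
    have : k ≠ 0 := fun h => r.ne_zero (by rw [← hkl, h, zero_mul])
    exact_mod_cast this
  by_cases hy : y ∈ L.scaledDual l
  · have hx : x ∈ L.scaledDual l := by
      have := add_mem (hsub hxy) hy
      rwa [sub_add_cancel] at this
    rw [heckeTerm, heckeTerm, dif_pos hx, dif_pos hy]
    congr 1
    · obtain ⟨m, hm⟩ := L.mem_scaledDual.1 hy _ hxy
      obtain ⟨n, hn⟩ := L.even _ hxy
      have hq : L.q x = L.q y + L.form y (x - y) + n := by
        have := L.q_add y (x - y)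
        rw [add_sub_cancel] at this
        rw [this]
        simp only [q, hn]
        ring
      have hr : ∀ z, (s : ℚ) / k * (L.rescale r).q z = s * (l * L.q z) := fun z => by
        have : (L.rescale r).q z = (k * l : ℚ) * L.q z := by
          simp only [q, rescale, LinearMap.smul_apply, smul_eq_mul]
          rw [← hkl]; push_cast; ring
        rw [this]; field_simp
      have : -((s : ℚ) / k * (L.rescale r).q x)
          = -((s : ℚ) / k * (L.rescale r).q y) + ((-(s * m) - s * l * n : ℤ) : ℚ) := by
        rw [hr, hr, hq]
        push_cast
        rw [← hm]
        ring
      rw [this, e_add_int]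
    · congr 1
      rw [Submodule.Quotient.eq]
      change l • x - l • y ∈ L.carrier
      rw [← smul_sub]
      exact nsmul_mem hxy l
  · have hx : x ∉ L.scaledDual l := fun hx => hy (by
      have := sub_mem hx (hsub hxy)
      rwa [sub_sub_cancel] at this)
    rw [heckeTerm, heckeTerm, dif_neg hx, dif_neg hy]

variable (L)

/-- Given vectors `Ψ k l s ∈ ℂ[A]` for `k l = r`, `0 ≤ s < l`, and a real number `κ`, the vector
`r^(κ - 1) ∑_{μ ∈ A(r)} (∑_{k l = r} l^(-κ) ∑_{s = 0}^{l - 1}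
  Δ_r(μ, k) 𝒆(-(s / k) q_r(μ)) (Ψ k l s)_{l μ}) e_μ` of `ℂ[A(r)]`. -/
def heckeSum (r : ℕ+) (κ : ℝ) (Ψ : ℕ → ℕ → ℕ → L.Disc → ℂ) : (L.rescale r).Disc → ℂ :=
  fun μ => (((r : ℕ) : ℝ) ^ (κ - 1) : ℝ) *
    Quotient.liftOn' μ
      (fun x => ∑ p ∈ (r : ℕ).divisorsAntidiagonal, (1 / ((p.2 : ℝ) ^ κ : ℝ) : ℂ) *
        ∑ s ∈ Finset.range p.2, L.heckeTerm r p.1 p.2 s (Ψ p.1 p.2 s) x)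
      (by
        intro x y hxy
        rw [Submodule.quotientRel_def] at hxy
        have h : (x : V) - y ∈ (L.rescale r).carrier := by
          simpa [Submodule.submoduleOf] using hxy
        refine Finset.sum_congr rfl fun p hp => ?_
        congr 1
        refine Finset.sum_congr rfl fun s _ => ?_
        exact heckeTerm_congr r _ _ _ (Nat.mem_divisorsAntidiagonal.1 hp).1 _ _ _ h)

/-- For the weight `(v, v̄) = (m / 2, n / 2)`, the sum `w + w̄` where
`(w, w̄) = (v + b⁺ / 2, v̄ + b⁻ / 2)`. -/
def totalWeight (m n : ℤ) : ℝ := ((m : ℝ) / 2 + L.bPos / 2) + ((n : ℝ) / 2 + L.bNeg / 2)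

end EvenLattice

/-- The point `(k τ + s) / l` of the upper half-plane, for positive integers `k, l`. -/
def heckePoint (k l s : ℕ) (τ : ℍ) : ℍ := UpperHalfPlane.ofComplex ((k * (τ : ℂ) + s) / l)

namespace EvenLattice

variable {V : Type*} [AddCommGroup V] [Module ℚ V] (L : EvenLattice V)

/-- The Hecke operator `𝒯_r` on functions `ψ(τ)`, for the weight `(m / 2, n / 2)`. -/
def heckeT (r : ℕ+) (m n : ℤ) (ψ : ℍ → L.Disc → ℂ) : ℍ → (L.rescale r).Disc → ℂ :=
  fun τ => L.heckeSum r (L.totalWeight m n) fun k l s => ψ (heckePoint k l s τ)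

/-- The Hecke operator `𝒯_r` on functions `ψ(τ, α, β)`, for the weight `(m / 2, n / 2)`; the
variables are substituted by `((k τ + s) / l, k α + s β, l β)`, as for the Hecke operators on
scalar-valued functions of `(τ, α, β)`. -/
def heckeTJacobi {W : Type*} [AddCommGroup W] (r : ℕ+) (m n : ℤ)
    (ψ : ℍ × W × W → L.Disc → ℂ) : ℍ × W × W → (L.rescale r).Disc → ℂ :=
  fun p => L.heckeSum r (L.totalWeight m n) fun k l s =>
    ψ (heckePoint k l s p.1, k • p.2.1 + s • p.2.2, l • p.2.2)

/-- The functions `Z_{r, δ}(τ)`, `δ ∈ A(r)`, built from `ψ(τ)`: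
`Z_{r, δ}(τ) = r^(-2) ∑_{k l = r} l ∑_{s = 0}^{l - 1}
  Δ_r(δ, k) 𝒆(-(s / k) q_r(δ)) ψ_{l δ}((k τ + s) / l)`. -/
def boundStateZ (r : ℕ+) (ψ : ℍ → L.Disc → ℂ) (δ : (L.rescale r).Disc) (τ : ℍ) : ℂ :=
  L.heckeSum r (-1) (fun k l s => ψ (heckePoint k l s τ)) δ

end EvenLattice

end VVHecke

end

noncomputable section

namespace VVHecke

open UpperHalfPlane

/-! ### Gaussians in one variable -/

/-! The proof tests everything on one family of functions for which modularity and the Hecke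
substitutions are explicit: the Siegel theta functions of the cosets `λ + L` with real
characteristics `(α, β)`. An orthogonal basis exhibiting the signature splits their Gaussian into
one-variable factors, complex conjugated in the negative directions. Their automorphy factor is
therefore `φ^{b⁺} φ̄^{b⁻}`.

Theta inversion (`theta_S`) and translation (`theta_T`) show that the vector of theta functions
transforms under `S` and `T` by the two matrices defining `ρ_L`. At `τ = i` its components are
linearly independent as functions of the characteristics (`theta_independent`); this is what the
variables `α, β` are for. The matrix by which a metaplectic element acts is thus unique, so the Weil
representation exists (`IsSignatureBasis.exists_isWeilRep`), is unitary, and governs the theta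
functions of every metaplectic element.

The substitution `((k τ + s) / l, k α + s β, l β)` carries the theta vector of `L` to the adjoint of
a Hecke matrix applied to the theta vector of `L(r)` (`theta_heckeAct`). If `(k s; 0 l) g = γ (k'
s'; 0 l')`, evaluating theta at both sides and cancelling it by independence gives a relation
between Hecke matrices and Weil matrices alone (`heckeMatrix_intertwine`). No Gauss sum is computed.

Finally, right multiplication by `g` permutes the left cosets of the matrices `(k s; 0 l)`
(`exists_perm_heckeIndex`). The intertwining relation then matches the summands of the transformed
Hecke sum one by one; the powers of `√(l / l')` that arise are absorbed by the weights `l^{-(w +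
w̄)}` (`scaling_identity`). -/

/-- The Gaussian `x ↦ 𝒆(D τ (x + β)² / 2 - D (x + β / 2) α)` on the real line. -/
def gauss₁ (D : ℝ) (τ : ℍ) (α β x : ℝ) : ℂ :=
  Complex.exp (2 * Real.pi * Complex.I *
    (D * (τ : ℂ) * (x + β) ^ 2 / 2 - D * (x + β / 2) * α))

theorem coe_S_smul (τ : ℍ) : ((ModularGroup.S • τ : ℍ) : ℂ) = -1 / (τ : ℂ) := by
  rw [UpperHalfPlane.modular_S_smul]
  simp [neg_div, inv_neg]

/-- Expanding the square around `c` separates a factor free of `n`; the rest is the general term of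
Jacobi's theta function. Convergence and inversion are both inherited through this identity. -/
theorem gauss₁_eq_theta_term (D : ℝ) (τ : ℍ) (α β c h : ℝ) (n : ℤ) :
    gauss₁ D τ α β (c + h * n) =
      Complex.exp (2 * Real.pi * Complex.I *
        (D * (τ : ℂ) * (c + β) ^ 2 / 2 - D * (c + β / 2) * α)) *
      jacobiTheta₂_term n (D * h * (τ * (c + β) - α)) (D * h ^ 2 * τ) := by
  rw [gauss₁, jacobiTheta₂_term, ← Complex.exp_add]
  congr 1
  push_cast
  ring

theorem im_scaled_pos {D h : ℝ} (hD : 0 < D) (hh : h ≠ 0) (τ : ℍ) :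
    0 < ((D : ℂ) * (h : ℂ) ^ 2 * (τ : ℂ)).im := by
  have : ((D : ℂ) * (h : ℂ) ^ 2 * (τ : ℂ)).im = D * h ^ 2 * τ.im := by
    rw [show ((D : ℂ) * (h : ℂ) ^ 2) = ((D * h ^ 2 : ℝ) : ℂ) by push_cast; ring,
      Complex.im_ofReal_mul]
    rfl
  rw [this]
  have := τ.im_pos
  positivity

theorem summable_norm_gauss₁ {D h : ℝ} (hD : 0 < D) (hh : h ≠ 0) (τ : ℍ) (α β c : ℝ) :
    Summable fun n : ℤ => ‖gauss₁ D τ α β (c + h * n)‖ := by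
  simp only [gauss₁_eq_theta_term, norm_mul]
  exact (((summable_jacobiTheta₂_term_iff _ _).2 (im_scaled_pos hD hh τ)).norm).mul_left _

theorem tsum_gauss₁ {D h : ℝ} (τ : ℍ) (α β c : ℝ) :
    ∑' n : ℤ, gauss₁ D τ α β (c + h * n) =
      Complex.exp (2 * Real.pi * Complex.I *
        (D * (τ : ℂ) * (c + β) ^ 2 / 2 - D * (c + β / 2) * α)) *
      jacobiTheta₂ (D * h * (τ * (c + β) - α)) (D * h ^ 2 * τ) := by
  simp only [gauss₁_eq_theta_term, tsum_mul_left, jacobiTheta₂]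

/-- Jacobi's functional equation involves `(-i t)^{1/2}`, whereas the generator `S` carries `√τ`.
The arguments of `-i` and of `τ` add up within the principal range, so the two branches differ
exactly by `𝒆(-1/8)`, the source of the eighth root of unity in `ρ_L(S)`. -/
theorem cpow_half_rotate {a : ℝ} (ha : 0 < a) (τ : ℍ) :
    (-Complex.I * (a * (τ : ℂ))) ^ (1 / 2 : ℂ) =
      Real.sqrt a * (e (-1 / 8) * (τ : ℂ) ^ (1 / 2 : ℂ)) := by
  have hτ : (τ : ℂ) ≠ 0 := τ.ne_zero
  have ha' : (a : ℂ) ≠ 0 := by exact_mod_cast ha.ne'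
  have h0 : 0 ≤ Complex.arg (τ : ℂ) := Complex.arg_nonneg_iff.2 τ.im_pos.le
  have h1 := Complex.arg_le_pi (τ : ℂ)
  have hlog : Complex.log (-Complex.I * (τ : ℂ)) =
      -(Real.pi / 2) * Complex.I + Complex.log (τ : ℂ) := by
    rw [(Complex.log_mul_eq_add_log_iff (by simp) hτ).2, Complex.log_neg_I]
    rw [Complex.arg_neg_I]
    constructor <;> linarith [Real.pi_pos]
  have hne : -Complex.I * (τ : ℂ) ≠ 0 := mul_ne_zero (by simp) hτ
  rw [show -Complex.I * (a * (τ : ℂ)) = a * (-Complex.I * (τ : ℂ)) by ring,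
    Complex.cpow_def_of_ne_zero (mul_ne_zero ha' hne), Complex.log_ofReal_mul ha hne, hlog,
    Complex.cpow_def_of_ne_zero hτ, Real.sqrt_eq_rpow, Real.rpow_def_of_pos ha, e,
    Complex.ofReal_exp, ← Complex.exp_add, ← Complex.exp_add]
  congr 1
  push_cast
  ring

/-- Theta inversion in one variable. -/
theorem tsum_gauss₁_inversion {D h : ℝ} (hD : 0 < D) (hh : 0 < h) (τ : ℍ) (α β c : ℝ) :
    ∑' n : ℤ, gauss₁ D (ModularGroup.S • τ) (-β) α (c + h * n) =
      (e (-1 / 8) * (τ : ℂ) ^ (1 / 2 : ℂ) / (h * Real.sqrt D : ℝ)) *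
        ∑' n : ℤ, Complex.exp (-(2 * Real.pi * Complex.I * (c * n / h))) *
          gauss₁ D τ α β (n / (h * D)) := by
  have hτ : (τ : ℂ) ≠ 0 := τ.ne_zero
  have hD' : (D : ℂ) ≠ 0 := by exact_mod_cast hD.ne'
  have hh' : (h : ℂ) ≠ 0 := by exact_mod_cast hh.ne'
  -- The dual sum is a theta function with these parameters; the functional equation sends `(z, t)`
  -- to `(z / t, -1 / t)`, which are the parameters of the left-hand side.
  set z : ℂ := (τ * β - α - c) / h with hz
  set t : ℂ := ((1 / (D * h ^ 2) : ℝ) : ℂ) * τ with ht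
  have ht0 : t ≠ 0 := mul_ne_zero (by exact_mod_cast (by positivity)) hτ
  have hdual : ∀ n : ℤ, Complex.exp (-(2 * Real.pi * Complex.I * (c * n / h))) *
      gauss₁ D τ α β (n / (h * D)) =
      Complex.exp (2 * Real.pi * Complex.I * (D * (τ : ℂ) * β ^ 2 / 2 - D * (β / 2) * α)) *
        jacobiTheta₂_term n z t := fun n => by
    rw [gauss₁, jacobiTheta₂_term, ← Complex.exp_add, ← Complex.exp_add, hz, ht]
    congr 1
    push_cast
    field_simp
    ring
  rw [tsum_congr hdual, tsum_mul_left, tsum_gauss₁, ← jacobiTheta₂,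
    jacobiTheta₂_functional_equation z t, ht, cpow_half_rotate (by positivity), ← ht]
  have h1 : (D * h * (((ModularGroup.S • τ : ℍ) : ℂ) * (c + α) - (-β : ℝ)) : ℂ) = z / t := by
    rw [coe_S_smul, hz, ht]
    push_cast
    field_simp
    ring
  have h2 : (D * h ^ 2 * ((ModularGroup.S • τ : ℍ) : ℂ) : ℂ) = -1 / t := by
    rw [coe_S_smul, ht]
    push_cast
    field_simp
  have hsq : ((Real.sqrt (1 / (D * h ^ 2)) : ℝ) : ℂ) = 1 / (h * Real.sqrt D : ℝ) := by
    rw [← Complex.ofReal_one, ← Complex.ofReal_div]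
    congr 1
    rw [Real.sqrt_div zero_le_one, Real.sqrt_one, Real.sqrt_mul hD.le, Real.sqrt_sq hh.le,
      mul_comm]
  have hs0 : ((h * Real.sqrt D : ℝ) : ℂ) ≠ 0 := by
    have := Real.sqrt_pos.2 hD
    exact_mod_cast (by positivity)
  have he0 : e (-1 / 8) ≠ 0 := Complex.exp_ne_zero _
  have hc0 : (τ : ℂ) ^ (1 / 2 : ℂ) ≠ 0 := by
    rw [Complex.cpow_def_of_ne_zero hτ]; exact Complex.exp_ne_zero _
  have h3 : Complex.exp (2 * Real.pi * Complex.I *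
        (D * ((ModularGroup.S • τ : ℍ) : ℂ) * (c + α) ^ 2 / 2 - D * (c + α / 2) * (-β : ℝ))) =
      Complex.exp (2 * Real.pi * Complex.I * (D * (τ : ℂ) * β ^ 2 / 2 - D * (β / 2) * α)) *
        Complex.exp (-Real.pi * Complex.I * z ^ 2 / t) := by
    rw [← Complex.exp_add, coe_S_smul, hz, ht]
    congr 1
    push_cast
    field_simp
    ring
  rw [h1, h2, h3, hsq]
  generalize e (-1 / 8) = ζ at he0 ⊢
  field_simp

theorem coe_heckePoint {k l : ℕ} (hk : 0 < k) (hl : 0 < l) (s : ℕ) (τ : ℍ) :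
    (heckePoint k l s τ : ℂ) = (k * (τ : ℂ) + s) / l := by
  rw [heckePoint, UpperHalfPlane.ofComplex_apply_of_im_pos]
  have h : ((k * (τ : ℂ) + s) / l).im = k * τ.im / l := by
    rw [Complex.div_natCast_im]; simp
  rw [h]
  have := τ.im_pos
  positivity

/-- The part `k τ` rescales `D` to `k l D`. In the part containing `s`, the terms with `β` coming
from the square cancel against the shift of `α` by `s β`, leaving the pure phase `s l D y² / 2`. The
term `D (β / 2) α` in the Gaussian is what makes this exact. -/
theorem gauss₁_hecke (D : ℝ) {k l : ℕ} (hk : 0 < k) (hl : 0 < l) (s : ℕ) (τ : ℍ) (α β y : ℝ) :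
    gauss₁ D (heckePoint k l s τ) (k * α + s * β) (l * β) (l * y) =
      Complex.exp (2 * Real.pi * Complex.I * (s * l * (D * y ^ 2 / 2))) *
        gauss₁ (k * l * D) τ α β y := by
  have : (l : ℂ) ≠ 0 := by exact_mod_cast hl.ne'
  rw [gauss₁, gauss₁, ← Complex.exp_add, coe_heckePoint hk hl]
  congr 1
  push_cast
  field_simp
  ring

theorem gauss₁_shift (D : ℝ) (τ : ℍ) (α β δ x : ℝ) :
    gauss₁ D τ (α + δ) β x =
      Complex.exp (-(2 * Real.pi * Complex.I * (D * (x + β / 2) * δ))) * gauss₁ D τ α β x := by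
  rw [gauss₁, gauss₁, ← Complex.exp_add]
  congr 1
  push_cast
  ring

theorem gauss₁_I (D β x : ℝ) :
    gauss₁ D UpperHalfPlane.I 0 β x = (Real.exp (-(Real.pi * D * (x + β) ^ 2)) : ℝ) := by
  rw [gauss₁, Complex.ofReal_exp]
  congr 1
  push_cast
  linear_combination (Real.pi * D * (x + β) ^ 2 : ℂ) * Complex.I_mul_I

/-! ### Gaussians attached to a sign -/

/-- The identity of `ℂ` if `D > 0`, complex conjugation otherwise. -/
def signConj (D : ℝ) : ℂ →+* ℂ := if 0 < D then RingHom.id ℂ else starRingEnd ℂ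

theorem signConj_of_pos {D : ℝ} (hD : 0 < D) (z : ℂ) : signConj D z = z := by
  simp [signConj, hD]

theorem signConj_of_neg {D : ℝ} (hD : D < 0) (z : ℂ) : signConj D z = conj z := by
  simp [signConj, hD.le.not_gt]

@[simp] theorem signConj_ofReal (D x : ℝ) : signConj D (x : ℂ) = x := by
  unfold signConj; split_ifs <;> simp

@[simp] theorem norm_signConj (D : ℝ) (z : ℂ) : ‖signConj D z‖ = ‖z‖ := by
  unfold signConj; split_ifs <;> simp

theorem signConj_tsum (D : ℝ) {ι : Type*} (f : ι → ℂ) :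
    signConj D (∑' n, f n) = ∑' n, signConj D (f n) := by
  unfold signConj; split_ifs
  · simp
  · exact Complex.conj_tsum f

/-- Conjugation reverses a real phase and so turns `|D|` back into `D`; in this way identities for
positive Gaussians acquire phases given by the indefinite form. -/
theorem signConj_exp (D x : ℝ) :
    signConj D (Complex.exp (2 * Real.pi * Complex.I * (|D| * x : ℝ))) =
      Complex.exp (2 * Real.pi * Complex.I * (D * x : ℝ)) := by
  rcases lt_or_ge 0 D with hD | hD
  · rw [signConj_of_pos hD, abs_of_pos hD]
  · rcases hD.eq_or_lt with rfl | hD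
    · simp
    rw [signConj_of_neg hD, abs_of_neg hD, ← Complex.exp_conj]
    congr 1
    simp [map_ofNat]

/-- The Gaussian `gauss₁ |D|`, conjugated if `D < 0`. -/
def signGauss (D : ℝ) (τ : ℍ) (α β x : ℝ) : ℂ := signConj D (gauss₁ |D| τ α β x)

theorem summable_norm_signGauss {D h : ℝ} (hD : D ≠ 0) (hh : h ≠ 0) (τ : ℍ) (α β c : ℝ) :
    Summable fun n : ℤ => ‖signGauss D τ α β (c + h * n)‖ := by
  simpa only [signGauss, norm_signConj] using
    summable_norm_gauss₁ (abs_pos.2 hD) hh τ α β c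

/-- The constant `𝒆(∓ 1 / 8) / √|D|` of theta inversion. -/
def inversionConst (D : ℝ) : ℂ := signConj D (e (-1 / 8)) / Real.sqrt |D|

theorem tsum_signGauss_inversion {D h : ℝ} (hD : D ≠ 0) (hh : 0 < h) (τ : ℍ) (α β c : ℝ) :
    ∑' n : ℤ, signGauss D (ModularGroup.S • τ) (-β) α (c + h * n) =
      (signConj D ((τ : ℂ) ^ (1 / 2 : ℂ)) * (inversionConst D / h)) *
        ∑' n : ℤ, Complex.exp (-(2 * Real.pi * Complex.I * (c * n / h))) *
          signGauss D τ α β (n / (h * D)) := by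
  simp only [signGauss]
  rw [← signConj_tsum, tsum_gauss₁_inversion (abs_pos.2 hD) hh, map_mul, signConj_tsum]
  congr 1
  · rw [map_div₀, map_mul, signConj_ofReal, inversionConst]
    push_cast
    ring
  · rcases lt_or_gt_of_ne hD with hD | hD
    · rw [← (Equiv.neg ℤ).tsum_eq]
      refine tsum_congr fun n => ?_
      rw [map_mul, abs_of_neg hD]
      congr 1
      · rw [signConj_of_neg hD, ← Complex.exp_conj]
        congr 1
        simp [map_ofNat]
        ring
      · congr 2
        simp
    · refine tsum_congr fun n => ?_
      rw [map_mul, abs_of_pos hD, signConj_of_pos hD]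

theorem signGauss_hecke (D : ℝ) {k l : ℕ} (hk : 0 < k) (hl : 0 < l) (s : ℕ) (τ : ℍ)
    (α β y : ℝ) :
    signGauss D (heckePoint k l s τ) (k * α + s * β) (l * β) (l * y) =
      Complex.exp (2 * Real.pi * Complex.I * (D * (s * l * (y ^ 2 / 2)) : ℝ)) *
        signGauss (k * l * D) τ α β y := by
  have hkl : (0 : ℝ) < k * l := by positivity
  have hs : signConj (k * l * D) = signConj D := by
    simp only [signConj, mul_pos_iff_of_pos_left hkl]
  rw [signGauss, gauss₁_hecke _ hk hl, signGauss, hs, abs_mul, abs_of_pos hkl, map_mul,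
    ← signConj_exp]
  congr 3
  push_cast
  ring

theorem signGauss_shift (D : ℝ) (τ : ℍ) (α β δ x : ℝ) :
    signGauss D τ (α + δ) β x =
      Complex.exp (2 * Real.pi * Complex.I * (D * (-(x + β / 2) * δ) : ℝ)) *
        signGauss D τ α β x := by
  rw [signGauss, signGauss, gauss₁_shift, map_mul, ← signConj_exp]
  congr 3
  push_cast
  ring

theorem signGauss_I (D β x : ℝ) :
    signGauss D UpperHalfPlane.I 0 β x = (Real.exp (-(Real.pi * |D| * (x + β) ^ 2)) : ℝ) := by
  rw [signGauss, gauss₁_I, signConj_ofReal]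

/-! ### Sums of products -/

/-- Induction on the dimension, splitting off the first coordinate and multiplying two absolutely
convergent series. -/
theorem summable_and_tsum_pi_prod_fin (d : ℕ) (f : Fin d → ℤ → ℂ)
    (hf : ∀ i, Summable fun n => ‖f i n‖) :
    Summable (fun n : Fin d → ℤ => ‖∏ i, f i (n i)‖) ∧
      ∑' n : Fin d → ℤ, ∏ i, f i (n i) = ∏ i, ∑' n, f i n := by
  induction d with
  | zero => exact ⟨(hasSum_fintype _).summable, by simp⟩
  | succ d ih =>
    obtain ⟨h1, h2⟩ := ih (fun i => f i.succ) fun i => hf _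
    have key : ∀ x : ℤ × (Fin d → ℤ), ∏ i, f i (Fin.consEquiv (fun _ => ℤ) x i) =
        f 0 x.1 * ∏ i : Fin d, f i.succ (x.2 i) := fun x => by
      simp [Fin.prod_univ_succ, Fin.consEquiv]
    constructor
    · rw [← (Fin.consEquiv (fun _ : Fin (d + 1) => ℤ)).summable_iff]
      refine (Summable.mul_norm (f := f 0) (g := fun n : Fin d → ℤ => ∏ i : Fin d, f i.succ (n i))
        (hf 0) h1).congr fun x => ?_
      rw [Function.comp_apply, key]
    · rw [← (Fin.consEquiv (fun _ : Fin (d + 1) => ℤ)).tsum_eq, tsum_congr key,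
        Fin.prod_univ_succ, ← h2, tsum_mul_tsum_of_summable_norm (hf 0) h1]

theorem summable_and_tsum_pi_prod {ι : Type*} [Fintype ι] (f : ι → ℤ → ℂ)
    (hf : ∀ i, Summable fun n => ‖f i n‖) :
    Summable (fun n : ι → ℤ => ‖∏ i, f i (n i)‖) ∧
      ∑' n : ι → ℤ, ∏ i, f i (n i) = ∏ i, ∑' n, f i n := by
  let ε := Fintype.equivFin ι
  obtain ⟨h1, h2⟩ := summable_and_tsum_pi_prod_fin _ (fun i => f (ε.symm i)) fun i => hf _
  have key : ∀ n : Fin (Fintype.card ι) → ℤ,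
      ∏ i, f i (ε.symm.arrowCongr (Equiv.refl ℤ) n i) = ∏ i, f (ε.symm i) (n i) := fun n => by
    rw [← ε.symm.prod_comp]
    simp
  constructor
  · rw [← (ε.symm.arrowCongr (Equiv.refl ℤ)).summable_iff]
    simpa only [Function.comp_def, key] using h1
  · rw [← (ε.symm.arrowCongr (Equiv.refl ℤ)).tsum_eq, tsum_congr key, h2,
      ← ε.symm.prod_comp]

/-! ### Gaussians in several variables -/

section Several

variable {ι : Type*} [Fintype ι]

/-- The product of the one-dimensional Gaussians `signGauss (D i)`. -/
def gauss (D : ι → ℝ) (p : ℍ × (ι → ℝ) × (ι → ℝ)) (x : ι → ℝ) : ℂ :=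
  ∏ i, signGauss (D i) p.1 (p.2.1 i) (p.2.2 i) (x i)

/-- The automorphy factor `z ↦ ∏ i, signConj (D i) z` of the Gaussians. -/
def gaussFactor (D : ι → ℝ) : ℂ →* ℂ where
  toFun z := ∏ i, signConj (D i) z
  map_one' := by simp
  map_mul' x y := by simp [Finset.prod_mul_distrib]

theorem summable_norm_gauss {D : ι → ℝ} (hD : ∀ i, D i ≠ 0) {h : ι → ℝ} (hh : ∀ i, h i ≠ 0)
    (p : ℍ × (ι → ℝ) × (ι → ℝ)) (c : ι → ℝ) :
    Summable fun n : ι → ℤ => ‖gauss D p fun i => c i + h i * n i‖ :=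
  (summable_and_tsum_pi_prod
    (fun i n => signGauss (D i) p.1 (p.2.1 i) (p.2.2 i) (c i + h i * n))
    fun i => summable_norm_signGauss (hD i) (hh i) _ _ _ _).1

/-- Over a rectangular lattice both sides factor into one-variable sums, to which inversion applies
coordinate by coordinate. -/
theorem tsum_gauss_inversion {D : ι → ℝ} (hD : ∀ i, D i ≠ 0) {h : ℝ} (hh : 0 < h)
    (p : ℍ × (ι → ℝ) × (ι → ℝ)) (c : ι → ℝ) :
    ∑' n : ι → ℤ, gauss D (jacobiAct ModularGroup.S p) (fun i => c i + h * n i) =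
      gaussFactor D (Mp2Z.S.phi p.1) * (∏ i, inversionConst (D i) / h) *
        ∑' n : ι → ℤ, Complex.exp (-(2 * Real.pi * Complex.I * (∑ i, c i * n i / h : ℝ))) *
          gauss D p (fun i => n i / (h * D i)) := by
  have h1 := (summable_and_tsum_pi_prod (fun i n => signGauss (D i) (ModularGroup.S • p.1)
    (-(p.2.2 i)) (p.2.1 i) (c i + h * n))
    fun i => summable_norm_signGauss (hD i) hh.ne' _ _ _ _).2
  have h2 := (summable_and_tsum_pi_prod (fun i n =>
    Complex.exp (-(2 * Real.pi * Complex.I * (c i * n / h))) *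
      signGauss (D i) p.1 (p.2.1 i) (p.2.2 i) (n / (h * D i))) fun i => by
      have h3 : ∀ n : ℤ, ‖Complex.exp (-(2 * Real.pi * Complex.I * (c i * n / h)))‖ = 1 :=
        fun n => by
          rw [Complex.norm_exp]
          simp [← Complex.ofReal_intCast, ← Complex.ofReal_div, ← Complex.ofReal_mul]
      simp only [norm_mul, h3, one_mul]
      have := summable_norm_signGauss (hD i) (h := 1 / (h * D i))
        (one_div_ne_zero (mul_ne_zero hh.ne' (hD i))) p.1 (p.2.1 i) (p.2.2 i) 0
      refine this.congr fun n => ?_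
      congr 2
      ring).2
  have h4 : ∀ n : ι → ℤ, gauss D (jacobiAct ModularGroup.S p) (fun i => c i + h * n i) =
      ∏ i, signGauss (D i) (ModularGroup.S • p.1) (-(p.2.2 i)) (p.2.1 i) (c i + h * n i) :=
    fun n => by
      simp [gauss, jacobiAct, ModularGroup.S]
  rw [tsum_congr h4, h1]
  simp only [tsum_signGauss_inversion (hD _) hh, Finset.prod_mul_distrib]
  rw [← Finset.prod_mul_distrib, ← h2, Finset.prod_mul_distrib]
  congr 1
  refine tsum_congr fun n => ?_
  rw [Finset.prod_mul_distrib, ← Complex.exp_sum, gauss]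
  congr 2
  push_cast
  rw [Finset.mul_sum, ← Finset.sum_neg_distrib]

theorem gauss_hecke (D : ι → ℝ) {k l : ℕ} (hk : 0 < k) (hl : 0 < l) (s : ℕ)
    (p : ℍ × (ι → ℝ) × (ι → ℝ)) (y : ι → ℝ) :
    gauss D (heckePoint k l s p.1, k • p.2.1 + s • p.2.2, l • p.2.2) (fun i => l * y i) =
      Complex.exp (2 * Real.pi * Complex.I * (s * l * ((∑ i, D i * y i * y i) / 2) : ℝ)) *
        gauss (fun i => k * l * D i) p y := by
  simp only [gauss, Pi.add_apply, Pi.smul_apply]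
  simp only [nsmul_eq_mul, signGauss_hecke _ hk hl, Finset.prod_mul_distrib, ← Complex.exp_sum]
  congr 2
  rw [← Finset.mul_sum, ← Complex.ofReal_sum]
  congr 2
  rw [Finset.sum_div, Finset.mul_sum]
  exact Finset.sum_congr rfl fun i _ => by ring

theorem gauss_shift (D : ι → ℝ) (τ : ℍ) (α β δ x : ι → ℝ) :
    gauss D (τ, α + δ, β) x =
      Complex.exp (-(2 * Real.pi * Complex.I * (∑ i, D i * x i * δ i : ℝ))) *
      Complex.exp (-(2 * Real.pi * Complex.I * (∑ i, D i * (β i / 2) * δ i : ℝ))) *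
        gauss D (τ, α, β) x := by
  simp only [gauss, Pi.add_apply, signGauss_shift, Finset.prod_mul_distrib, ← Complex.exp_sum,
    ← Complex.exp_add]
  congr 2
  push_cast
  simp only [← Finset.mul_sum, ← mul_neg, ← mul_add, ← Finset.sum_neg_distrib,
    ← Finset.sum_add_distrib]
  congr 1
  exact Finset.sum_congr rfl fun i _ => by ring

theorem gauss_I_pos (D : ι → ℝ) (β x : ι → ℝ) :
    ∃ a : ℝ, 0 < a ∧ gauss D (UpperHalfPlane.I, 0, β) x = a := by
  refine ⟨∏ i, Real.exp (-(Real.pi * |D i| * (x i + β i) ^ 2)),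
    Finset.prod_pos fun i _ => Real.exp_pos _, ?_⟩
  simp only [gauss, Pi.zero_apply, signGauss_I, Complex.ofReal_prod]

end Several

/-! ### The discriminant pairing -/

theorem e_eq_one_iff (x : ℚ) : e x = 1 ↔ ∃ n : ℤ, x = n := by
  constructor
  · intro h
    obtain ⟨n, hn⟩ := Complex.exp_eq_one_iff.1 h
    refine ⟨n, ?_⟩
    have h2 : (2 * Real.pi * Complex.I : ℂ) ≠ 0 := Complex.two_pi_I_ne_zero
    rw [mul_comm (n : ℂ)] at hn
    exact_mod_cast mul_left_cancel₀ h2 hn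
  · rintro ⟨n, rfl⟩
    exact e_int n

theorem exp_eq_e {x : ℚ} {y : ℝ} (h : (x : ℝ) = y) :
    Complex.exp (2 * Real.pi * Complex.I * (y : ℂ)) = e x := by
  rw [e, ← h]
  simp

theorem e_neg (x : ℚ) : e (-x) = conj (e x) := by
  rw [e, e, ← Complex.exp_conj]
  congr 1
  simp [map_ofNat]

theorem norm_e (x : ℚ) : ‖e x‖ = 1 := by
  rw [← exp_eq_e (y := x) rfl, mul_assoc, mul_comm Complex.I, ← mul_assoc,
    show (2 * Real.pi * (x : ℝ) : ℂ) = ((2 * Real.pi * x : ℝ) : ℂ) by push_cast; ring,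
    Complex.norm_exp_ofReal_mul_I]

namespace EvenLattice

variable {V : Type*} [AddCommGroup V] [Module ℚ V] (L : EvenLattice V)

/-- A finitely generated torsion-free `ℤ`-module is free, and a `ℤ`-basis stays independent over the
fraction field. -/
theorem exists_basis_span_eq : ∃ (n : ℕ) (b : Module.Basis (Fin n) ℚ V),
    Submodule.span ℤ (Set.range b) = L.carrier := by
  have : Module.Finite ℤ L.carrier := Module.Finite.iff_fg.2 L.fg
  have : Module.IsTorsionFree ℤ V := Module.IsTorsionFree.trans_faithfulSMul ℤ ℚ V
  have : Module.Free ℤ L.carrier := inferInstance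
  let b := Module.finBasis ℤ L.carrier
  have hspan : Submodule.span ℤ (Set.range fun i => (b i : V)) = L.carrier := by
    have h := congrArg (Submodule.map L.carrier.subtype) b.span_eq
    rwa [Submodule.map_span, ← Set.range_comp, Submodule.map_top, Submodule.range_subtype] at h
  have hli : LinearIndependent ℚ fun i => (b i : V) := by
    rw [← LinearIndependent.iff_fractionRing (R := ℤ)]
    exact b.linearIndependent.map' L.carrier.subtype (Submodule.ker_subtype _)
  refine ⟨_, Module.Basis.mk hli ?_, ?_⟩
  · rw [← L.span_eq_top, Submodule.span_le]
    exact Set.Subset.trans (show (L.carrier : Set V) ⊆ _ from hspan.ge)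
      (Submodule.span_subset_span ℤ ℚ _)
  · rwa [Module.Basis.coe_mk]

/-- Double duality `L'' = L`; it makes the discriminant pairing nondegenerate. -/
theorem mem_carrier_of_integral {x : V} (hx : ∀ y ∈ L.dual, ∃ n : ℤ, L.form x y = n) :
    x ∈ L.carrier := by
  obtain ⟨n, b, hb⟩ := L.exists_basis_span_eq
  have h := LinearMap.BilinForm.dualSubmodule_dualSubmodule_of_basis (R := ℤ) (B := L.form)
    L.nondegenerate ⟨fun x y => L.symm x y⟩ b
  rw [hb] at h
  rw [← h, LinearMap.BilinForm.mem_dualSubmodule]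
  intro y hy
  obtain ⟨m, hm⟩ := hx y hy
  rw [Submodule.mem_one]
  exact ⟨m, by simp [hm]⟩

theorem toDisc_eq_iff (x y : L.dual) : L.toDisc x = L.toDisc y ↔ (x : V) - y ∈ L.carrier := by
  rw [Submodule.Quotient.eq]
  rfl

theorem toDisc_surjective : Function.Surjective L.toDisc := Submodule.Quotient.mk_surjective _

theorem ePair_mk (x y : L.dual) : L.ePair (L.toDisc x) (L.toDisc y) = e (-L.form x y) := rfl

theorem eQ_mk (x : L.dual) : L.eQ (L.toDisc x) = e (L.q x) := rfl

theorem ePair_comm (a b : L.Disc) : L.ePair a b = L.ePair b a := by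
  obtain ⟨x, rfl⟩ := L.toDisc_surjective a
  obtain ⟨y, rfl⟩ := L.toDisc_surjective b
  rw [ePair_mk, ePair_mk, L.symm]

theorem ePair_add_left (a a' b : L.Disc) :
    L.ePair (a + a') b = L.ePair a b * L.ePair a' b := by
  obtain ⟨x, rfl⟩ := L.toDisc_surjective a
  obtain ⟨x', rfl⟩ := L.toDisc_surjective a'
  obtain ⟨y, rfl⟩ := L.toDisc_surjective b
  change e (-L.form (x + x') y) = e (-L.form x y) * e (-L.form x' y)
  rw [← e_add, map_add, LinearMap.add_apply, neg_add]

theorem ePair_neg_left (a b : L.Disc) : L.ePair (-a) b = conj (L.ePair a b) := by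
  obtain ⟨x, rfl⟩ := L.toDisc_surjective a
  obtain ⟨y, rfl⟩ := L.toDisc_surjective b
  change e (-L.form (-x) y) = conj (e (-L.form x y))
  rw [← e_neg, map_neg, LinearMap.neg_apply]

theorem exists_ePair_ne_one {a : L.Disc} (ha : a ≠ 0) : ∃ b, L.ePair a b ≠ 1 := by
  obtain ⟨x, rfl⟩ := L.toDisc_surjective a
  by_contra! h
  apply ha
  rw [show (0 : L.Disc) = L.toDisc 0 from rfl, toDisc_eq_iff]
  simp only [ZeroMemClass.coe_zero, sub_zero]
  refine L.mem_carrier_of_integral fun y hy => ?_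
  obtain ⟨n, hn⟩ := (e_eq_one_iff _).1 (h (L.toDisc ⟨y, hy⟩))
  exact ⟨-n, by push_cast; rw [← hn, neg_neg]⟩

/-- If `a ≠ 0`, translating the summation variable by some `c` with `ePair a c ≠ 1` multiplies the
sum by that value, so the sum vanishes. -/
theorem sum_ePair (a : L.Disc) :
    ∑ b, L.ePair a b = if a = 0 then (Fintype.card L.Disc : ℂ) else 0 := by
  split_ifs with ha
  · subst ha
    have : ∀ b, L.ePair 0 b = 1 := fun b => by
      obtain ⟨y, rfl⟩ := L.toDisc_surjective b
      change e (-L.form ((0 : L.dual) : V) y) = 1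
      simpa using e_int 0
    simp [this]
  · obtain ⟨c, hc⟩ := L.exists_ePair_ne_one ha
    have h : ∑ b, L.ePair a b = L.ePair a c * ∑ b, L.ePair a b := by
      rw [Finset.mul_sum, ← Equiv.sum_comp (Equiv.addLeft c) fun b => L.ePair a b]
      refine Finset.sum_congr rfl fun b _ => ?_
      rw [Equiv.coe_addLeft, L.ePair_comm, ePair_add_left, L.ePair_comm c, L.ePair_comm b]
    have h2 : (1 - L.ePair a c) * ∑ b, L.ePair a b = 0 := by rw [sub_mul, one_mul, ← h, sub_self]
    exact (mul_eq_zero.1 h2).resolve_left (sub_ne_zero.2 hc.symm)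

/-! ### Coordinates with respect to an orthogonal basis -/

section Coordinates

/-- The coordinates of `x` as real numbers. -/
def coords {ι : Type*} (b : Module.Basis ι ℚ V) (x : V) : ι → ℝ := fun i => (b.repr x i : ℝ)

theorem coords_add {ι : Type*} (b : Module.Basis ι ℚ V) (x y : V) :
    coords b (x + y) = coords b x + coords b y := by
  ext i; simp [coords]

variable {ι : Type*} [Fintype ι] (b : Module.Basis ι ℚ V)

/-- The values `(b i, b i)` as real numbers. -/
def diag (b : Module.Basis ι ℚ V) : ι → ℝ := fun i => (L.form (b i) (b i) : ℝ)

theorem form_eq_sum (hb : ∀ i j, i ≠ j → L.form (b i) (b j) = 0) (x y : V) :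
    L.form x y = ∑ i, L.form (b i) (b i) * b.repr x i * b.repr y i := by
  classical
  conv_lhs => rw [← b.sum_repr x, ← b.sum_repr y]
  simp only [map_sum, LinearMap.sum_apply, map_smul, LinearMap.smul_apply, smul_eq_mul]
  refine Finset.sum_congr rfl fun i _ => ?_
  rw [Finset.sum_eq_single i]
  · ring
  · intro j _ hj
    rw [hb _ _ hj]
    simp
  · simp

theorem form_eq_sum_real (hb : ∀ i j, i ≠ j → L.form (b i) (b j) = 0) (x y : V) :
    (L.form x y : ℝ) = ∑ i, L.diag b i * coords b x i * coords b y i := by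
  rw [L.form_eq_sum b hb]
  simp [diag, coords]

theorem form_basis_ne_zero (hb : ∀ i j, i ≠ j → L.form (b i) (b j) = 0) (i : ι) :
    L.form (b i) (b i) ≠ 0 := by
  intro h
  refine b.ne_zero i (L.nondegenerate.1 _ fun y => ?_)
  rw [L.form_eq_sum b hb]
  refine Finset.sum_eq_zero fun j _ => ?_
  rcases eq_or_ne j i with rfl | hj
  · rw [h]; ring
  · rw [b.repr_self, Finsupp.single_eq_of_ne hj]; ring

theorem diag_ne_zero (hb : ∀ i j, i ≠ j → L.form (b i) (b j) = 0) (i : ι) :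
    L.diag b i ≠ 0 := by
  have := L.form_basis_ne_zero b hb i
  rw [diag]
  exact_mod_cast this

/-- The Gaussian on `V` defined through the coordinates with respect to `b`. -/
def vgauss (p : ℍ × (ι → ℝ) × (ι → ℝ)) (x : V) : ℂ := gauss (L.diag b) p (coords b x)

/-- The phase `s l q(y)` equals `(s / k) q_r(y)` because `q_r = k l q`. It is the inverse of the
phase in the Hecke sum, which is why the adjoint of the Hecke matrix acts on theta functions. -/
theorem vgauss_hecke (hb : ∀ i j, i ≠ j → L.form (b i) (b j) = 0) (r : ℕ+) {k l : ℕ}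
    (hkl : k * l = r) (s : ℕ) (p : ℍ × (ι → ℝ) × (ι → ℝ)) (y : V) :
    L.vgauss b (heckePoint k l s p.1, k • p.2.1 + s • p.2.2, l • p.2.2) (l • y) =
      e ((s : ℚ) / k * (L.rescale r).q y) * (L.rescale r).vgauss b p y := by
  have hk : 0 < k := Nat.pos_of_ne_zero fun h => r.ne_zero (by rw [← hkl, h, zero_mul])
  have hl : 0 < l := Nat.pos_of_ne_zero fun h => r.ne_zero (by rw [← hkl, h, mul_zero])
  have h1 : coords b (l • y) = fun i => l * coords b y i := by
    ext i; simp [coords]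
  have h2 : (L.rescale r).diag b = fun i => k * l * L.diag b i := by
    ext i
    simp only [diag, rescale, LinearMap.smul_apply, smul_eq_mul, ← hkl]
    push_cast
    ring
  rw [vgauss, h1, gauss_hecke _ hk hl, vgauss, h2]
  congr 1
  apply exp_eq_e
  rw [← L.form_eq_sum_real b hb]
  simp only [q, rescale, LinearMap.smul_apply, smul_eq_mul, ← hkl]
  have : (k : ℝ) ≠ 0 := by exact_mod_cast hk.ne'
  push_cast
  field_simp

/-- Translating the characteristic `α` by a vector `δ` twists the Gaussian by the character `𝒆(-(x,
δ))`, up to a constant independent of `x`. -/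
theorem vgauss_shift (hb : ∀ i j, i ≠ j → L.form (b i) (b j) = 0) (τ : ℍ) (α β : ι → ℝ)
    (δ : V) : ∃ C : ℂ, C ≠ 0 ∧ ∀ x, L.vgauss b (τ, α + coords b δ, β) x =
      C * (e (-L.form x δ) * L.vgauss b (τ, α, β) x) := by
  refine ⟨_, Complex.exp_ne_zero (-(2 * Real.pi * Complex.I *
    (∑ i, L.diag b i * (β i / 2) * coords b δ i : ℝ))), fun x => ?_⟩
  rw [vgauss, gauss_shift, ← L.form_eq_sum_real b hb, ← mul_neg, ← Complex.ofReal_neg,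
    exp_eq_e (x := -L.form x δ) (by push_cast; rfl), vgauss]
  ring

end Coordinates

/-! ### Theta functions of cosets -/

section Theta

variable {ι : Type*} [Fintype ι] (b : Module.Basis ι ℚ V)

/-- The theta function `∑_{x ∈ λ + L} vgauss p x` of `λ ∈ A`. -/
def theta (p : ℍ × (ι → ℝ) × (ι → ℝ)) (a : L.Disc) : ℂ :=
  ∑' x : L.dual, if L.toDisc x = a then L.vgauss b p x else 0

theorem exists_smul_basis_mem : ∃ N : ℕ, 0 < N ∧ ∀ i, N • b i ∈ L.carrier := by
  choose n hn0 hn using fun i => L.exists_smul_mem (b i)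
  refine ⟨∏ i, n i, Nat.pos_of_ne_zero (Finset.prod_ne_zero_iff.2 fun i _ => hn0 i), fun i => ?_⟩
  obtain ⟨m, hm⟩ := Finset.dvd_prod_of_mem n (Finset.mem_univ i)
  rw [hm, mul_comm, mul_smul]
  exact nsmul_mem (hn i) m

/-- The vector with coordinates `n i / (N D i)`, where `D i = (b i, b i)`. -/
def dualVec (N : ℕ) (n : ι → ℤ) : V := ∑ i, ((n i : ℚ) / (N * L.form (b i) (b i))) • b i

theorem repr_dualVec (N : ℕ) (n : ι → ℤ) (i : ι) :
    b.repr (L.dualVec b N n) i = n i / (N * L.form (b i) (b i)) := by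
  classical
  simp [dualVec, Finsupp.single_apply]

theorem form_dualVec (hb : ∀ i j, i ≠ j → L.form (b i) (b j) = 0) (N : ℕ) (n : ι → ℤ) (x : V) :
    L.form x (L.dualVec b N n) = ∑ i, b.repr x i * n i / N := by
  rw [L.form_eq_sum b hb]
  refine Finset.sum_congr rfl fun i _ => ?_
  have := L.form_basis_ne_zero b hb i
  rw [repr_dualVec]
  field_simp

/-- The orthogonal lattice spanned by the `N b i` lies in `L`, so its dual contains `L'`; the
integers are `n i = (x, N b i)`. -/
theorem exists_dualVec_eq (hb : ∀ i j, i ≠ j → L.form (b i) (b j) = 0) {N : ℕ} (hN : 0 < N)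
    (hNb : ∀ i, N • b i ∈ L.carrier) (x : L.dual) : ∃ n, L.dualVec b N n = x := by
  choose n hn using fun i => L.mem_dual.1 x.2 _ (hNb i)
  refine ⟨n, b.ext_elem fun i => ?_⟩
  have h0 := L.form_basis_ne_zero b hb i
  have h1 : (N : ℚ) ≠ 0 := by exact_mod_cast hN.ne'
  rw [repr_dualVec, ← hn, map_nsmul, L.form_eq_sum b hb, Finset.sum_eq_single i]
  · rw [b.repr_self, Finsupp.single_eq_same, nsmul_eq_mul]
    field_simp
  · intro j _ hj
    rw [b.repr_self, Finsupp.single_eq_of_ne hj, mul_zero]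
  · simp

theorem summable_vgauss_dualVec (hb : ∀ i j, i ≠ j → L.form (b i) (b j) = 0) {N : ℕ}
    (hN : 0 < N) (p : ℍ × (ι → ℝ) × (ι → ℝ)) :
    Summable fun n : ι → ℤ => ‖L.vgauss b p (L.dualVec b N n)‖ := by
  have hN' : (N : ℝ) ≠ 0 := by exact_mod_cast hN.ne'
  refine (summable_norm_gauss (D := L.diag b) (L.diag_ne_zero b hb)
    (h := fun i => 1 / (N * L.diag b i))
    (fun i => one_div_ne_zero (mul_ne_zero hN' (L.diag_ne_zero b hb i))) p 0).congr fun n => ?_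
  rw [vgauss]
  congr 2
  ext i
  simp only [coords, repr_dualVec, diag, Pi.zero_apply]
  push_cast
  ring

theorem summable_vgauss_dual (hb : ∀ i j, i ≠ j → L.form (b i) (b j) = 0)
    (p : ℍ × (ι → ℝ) × (ι → ℝ)) : Summable fun x : L.dual => ‖L.vgauss b p x‖ := by
  obtain ⟨N, hN, hNb⟩ := L.exists_smul_basis_mem b
  choose n hn using L.exists_dualVec_eq b hb hN hNb
  have hinj : Function.Injective n := fun x y h => by
    apply Subtype.ext
    rw [← hn, ← hn, h]
  refine ((L.summable_vgauss_dualVec b hb hN p).comp_injective hinj).congr fun x => ?_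
  rw [Function.comp_apply, hn]

theorem summable_theta (hb : ∀ i j, i ≠ j → L.form (b i) (b j) = 0)
    (p : ℍ × (ι → ℝ) × (ι → ℝ)) (a : L.Disc) :
    Summable fun x : L.dual => if L.toDisc x = a then L.vgauss b p x else 0 := by
  refine Summable.of_norm_bounded (L.summable_vgauss_dual b hb p) fun x => ?_
  split_ifs <;> simp

theorem theta_mk (p : ℍ × (ι → ℝ) × (ι → ℝ)) (c : L.dual) :
    L.theta b p (L.toDisc c) = ∑' z : L.carrier, L.vgauss b p (c + z) := by
  let f : L.carrier → L.dual := fun z => c + ⟨z, L.carrier_le_dual z.2⟩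
  have hf : Function.Injective f := fun z w h => by
    have := congrArg (Subtype.val) (add_left_cancel h)
    exact Subtype.ext this
  rw [theta, ← hf.tsum_eq]
  · refine tsum_congr fun z => ?_
    rw [if_pos]
    · rfl
    · rw [toDisc_eq_iff]
      simp [f]
  · intro x hx
    by_cases h : L.toDisc x = L.toDisc c
    · rw [toDisc_eq_iff] at h
      exact ⟨⟨_, h⟩, Subtype.ext (by simp [f])⟩
    · simp [h] at hx

/-- Linear combinations of theta functions. -/
theorem sum_mul_theta (hb : ∀ i j, i ≠ j → L.form (b i) (b j) = 0)
    (p : ℍ × (ι → ℝ) × (ι → ℝ)) (v : L.Disc → ℂ) :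
    ∑ a, v a * L.theta b p a = ∑' x : L.dual, v (L.toDisc x) * L.vgauss b p x := by
  simp only [theta, ← tsum_mul_left]
  rw [← Summable.tsum_finsetSum fun a _ => (L.summable_theta b hb p a).mul_left _]
  refine tsum_congr fun x => ?_
  simp

/-! ### Independence -/

/-- At `τ = i`, `α = 0` every Gaussian is a positive real number, so no cancellation can occur. -/
theorem theta_I_ne_zero (hb : ∀ i j, i ≠ j → L.form (b i) (b j) = 0) (a : L.Disc)
    (β : ι → ℝ) : L.theta b (UpperHalfPlane.I, 0, β) a ≠ 0 := by
  choose g hg0 hg using fun x : V => gauss_I_pos (L.diag b) β (coords b x)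
  obtain ⟨c, rfl⟩ := L.toDisc_surjective a
  have h1 : L.theta b (UpperHalfPlane.I, 0, β) (L.toDisc c) =
      ((∑' x : L.dual, if L.toDisc x = L.toDisc c then g x else 0 : ℝ) : ℂ) := by
    rw [theta, Complex.ofReal_tsum]
    refine tsum_congr fun x => ?_
    rw [vgauss, hg]
    split_ifs <;> simp
  have h2 : Summable fun x : L.dual => if L.toDisc x = L.toDisc c then g x else 0 := by
    refine ((L.summable_theta b hb (UpperHalfPlane.I, 0, β) (L.toDisc c)).norm).congr
      fun x => ?_
    rw [vgauss, hg]
    split_ifs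
    · rw [Complex.norm_real, Real.norm_of_nonneg (hg0 _).le]
    · simp
  rw [h1, Complex.ofReal_ne_zero]
  refine (h2.tsum_pos (fun x => ?_) c ?_).ne'
  · split_ifs
    · exact (hg0 _).le
    · exact le_rfl
  · rw [if_pos rfl]; exact hg0 _

/-- Translating `α` by `δ ∈ L'` inserts the character `𝒆(-(λ, δ))` into a linear relation. Fourier
inversion on `A` then isolates a single term `v_λ θ_λ(i, 0, 0)`, whose theta value is nonzero. -/
theorem theta_independent (hb : ∀ i j, i ≠ j → L.form (b i) (b j) = 0) (v : L.Disc → ℂ)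
    (hv : ∀ α β, ∑ a, v a * L.theta b (UpperHalfPlane.I, α, β) a = 0) : v = 0 := by
  have h1 : ∀ d, ∑ a, v a * L.ePair a d * L.theta b (UpperHalfPlane.I, 0, 0) a = 0 := fun d => by
    obtain ⟨δ, rfl⟩ := L.toDisc_surjective d
    obtain ⟨C, hC, h⟩ := L.vgauss_shift b hb UpperHalfPlane.I 0 0 δ
    have h2 := hv (0 + coords b δ) 0
    rw [L.sum_mul_theta b hb] at h2 ⊢
    simp only [h] at h2
    refine (mul_eq_zero.1 ?_).resolve_left hC
    rw [← tsum_mul_left, ← h2]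
    refine tsum_congr fun x => ?_
    rw [ePair_mk]
    ring
  ext a
  have h3 : ∑ d, L.ePair (-a) d *
      ∑ c, v c * L.ePair c d * L.theta b (UpperHalfPlane.I, 0, 0) c = 0 := by simp [h1]
  simp only [Finset.mul_sum] at h3
  rw [Finset.sum_comm] at h3
  have h4 : ∀ c, ∑ d, L.ePair (-a) d * (v c * L.ePair c d * L.theta b (UpperHalfPlane.I, 0, 0) c)
      = v c * L.theta b (UpperHalfPlane.I, 0, 0) c *
        if c = a then (Fintype.card L.Disc : ℂ) else 0 := fun c => by
    have : (if c = a then (Fintype.card L.Disc : ℂ) else 0) =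
        if c + -a = 0 then (Fintype.card L.Disc : ℂ) else 0 := by
      simp only [add_neg_eq_zero]
    rw [this, ← L.sum_ePair, Finset.mul_sum]
    refine Finset.sum_congr rfl fun d _ => ?_
    rw [ePair_add_left]
    ring
  simp only [h4] at h3
  simpa [L.theta_I_ne_zero b hb] using h3

/-! ### Theta inversion -/

/-- The vector with coordinates `N n i`, as an element of `L`. -/
def latticeHom {N : ℕ} (hNb : ∀ i, N • b i ∈ L.carrier) : (ι → ℤ) →ₗ[ℤ] L.carrier :=
  Fintype.linearCombination ℤ fun i => (⟨N • b i, hNb i⟩ : L.carrier)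

theorem coe_latticeHom {N : ℕ} (hNb : ∀ i, N • b i ∈ L.carrier) (n : ι → ℤ) :
    (L.latticeHom b hNb n : V) = ∑ i, ((N : ℚ) * n i) • b i := by
  simp only [latticeHom, Fintype.linearCombination_apply, AddSubmonoidClass.coe_finsetSum,
    SetLike.val_smul]
  refine Finset.sum_congr rfl fun i _ => ?_
  rw [← Nat.cast_smul_eq_nsmul ℚ, ← Int.cast_smul_eq_zsmul ℚ, smul_smul, mul_comm]

theorem repr_latticeHom {N : ℕ} (hNb : ∀ i, N • b i ∈ L.carrier) (n : ι → ℤ) (i : ι) :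
    b.repr (L.latticeHom b hNb n : V) i = N * n i := by
  classical
  rw [coe_latticeHom]
  simp [Finsupp.single_apply]

theorem latticeHom_injective {N : ℕ} (hN : 0 < N) (hNb : ∀ i, N • b i ∈ L.carrier) :
    Function.Injective (L.latticeHom b hNb) := fun m n h => by
  ext i
  have h1 := L.repr_latticeHom b hNb m i
  rw [h, repr_latticeHom] at h1
  have h2 : (N : ℚ) ≠ 0 := by exact_mod_cast hN.ne'
  exact_mod_cast (mul_left_cancel₀ h2 h1).symm

/-- The quotient is finitely generated, and each class is killed by `N` times a common denominator
of its coordinates. -/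
theorem finite_quotient_latticeHom {N : ℕ} (hN : 0 < N) (hNb : ∀ i, N • b i ∈ L.carrier) :
    Finite (L.carrier ⧸ LinearMap.range (L.latticeHom b hNb)) := by
  have : Module.Finite ℤ L.carrier := Module.Finite.iff_fg.2 L.fg
  apply Module.finite_of_fg_torsion
  intro a
  obtain ⟨x, rfl⟩ := Submodule.Quotient.mk_surjective _ a
  set d : ℕ := ∏ i, (b.repr (x : V) i).den with hd
  have hd0 : d ≠ 0 := Finset.prod_ne_zero_iff.2 fun i _ => Rat.den_ne_zero _
  refine ⟨⟨(N * d : ℤ), mem_nonZeroDivisors_of_ne_zero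
    (by exact_mod_cast mul_ne_zero hN.ne' hd0)⟩, ?_⟩
  rw [Submonoid.smul_def, ← Submodule.Quotient.mk_smul, Submodule.Quotient.mk_eq_zero]
  have h : ∀ i, ∃ n : ℤ, (d : ℚ) * b.repr (x : V) i = n := fun i => by
    obtain ⟨m, hm⟩ := Finset.dvd_prod_of_mem (fun i => (b.repr (x : V) i).den) (Finset.mem_univ i)
    refine ⟨m * (b.repr (x : V) i).num, ?_⟩
    rw [hd, hm]
    push_cast
    rw [← Rat.den_mul_eq_num]
    ring
  choose n hn using h
  refine ⟨n, Subtype.ext (b.ext_elem fun i => ?_)⟩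
  rw [repr_latticeHom, ← hn]
  simp [← Int.cast_smul_eq_zsmul ℚ, mul_assoc]

end Theta

section Inversion

variable {ι : Type*} [Fintype ι] (b : Module.Basis ι ℚ V)

theorem tsum_vgauss_latticeHom (hb : ∀ i j, i ≠ j → L.form (b i) (b j) = 0) {N : ℕ} (hN : 0 < N)
    (hNb : ∀ i, N • b i ∈ L.carrier) (p : ℍ × (ι → ℝ) × (ι → ℝ)) (c : V) :
    ∑' n : ι → ℤ, L.vgauss b (jacobiAct ModularGroup.S p) (c + L.latticeHom b hNb n) =
      gaussFactor (L.diag b) (Mp2Z.S.phi p.1) * (∏ i, inversionConst (L.diag b i) / N) *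
        ∑' n : ι → ℤ, e (-L.form c (L.dualVec b N n)) * L.vgauss b p (L.dualVec b N n) := by
  have hN' : (0 : ℝ) < N := by exact_mod_cast hN
  have h := tsum_gauss_inversion (L.diag_ne_zero b hb) hN' p (coords b c)
  have h1 : ∀ n : ι → ℤ, L.vgauss b (jacobiAct ModularGroup.S p) (c + L.latticeHom b hNb n) =
      gauss (L.diag b) (jacobiAct ModularGroup.S p) (fun i => coords b c i + N * n i) :=
    fun n => by
      rw [vgauss, coords_add]
      congr 1
      ext i
      simp [coords, repr_latticeHom]
  rw [tsum_congr h1, h, Complex.ofReal_natCast]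
  congr 1
  refine tsum_congr fun n => ?_
  congr 1
  · rw [← mul_neg, ← Complex.ofReal_neg]
    apply exp_eq_e
    rw [L.form_dualVec b hb]
    simp [coords]
  · rw [vgauss]
    congr 1
    ext i
    simp [coords, repr_dualVec, diag]

/-- Orthogonality for the characters `x ↦ 𝒆(-(x, w))` of the quotient of `L` by an orthogonal
sublattice, where `w` lies in the dual of the sublattice. -/
theorem sum_quotient_character (hb : ∀ i j, i ≠ j → L.form (b i) (b j) = 0) {N : ℕ} (hN : 0 < N)
    (hNb : ∀ i, N • b i ∈ L.carrier)
    [Fintype (L.carrier ⧸ LinearMap.range (L.latticeHom b hNb))] (n : ι → ℤ)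
    [Decidable (L.dualVec b N n ∈ L.dual)] :
    ∑ u : L.carrier ⧸ LinearMap.range (L.latticeHom b hNb),
      e (-L.form (Quotient.out u : L.carrier) (L.dualVec b N n)) =
    if L.dualVec b N n ∈ L.dual then
      (Fintype.card (L.carrier ⧸ LinearMap.range (L.latticeHom b hNb)) : ℂ) else 0 := by
  set w := L.dualVec b N n
  have hw : ∀ m : ι → ℤ, ∃ k : ℤ, L.form (L.latticeHom b hNb m) w = k := fun m => by
    have hN' : (N : ℚ) ≠ 0 := by exact_mod_cast hN.ne'
    refine ⟨∑ i, m i * n i, ?_⟩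
    rw [L.form_dualVec b hb]
    push_cast
    refine Finset.sum_congr rfl fun i _ => ?_
    rw [repr_latticeHom]
    field_simp
  -- The character is trivial on the sublattice, so the choice of coset representatives does not
  -- matter.
  have hcongr : ∀ x y : L.carrier,
      (Submodule.Quotient.mk x : L.carrier ⧸ LinearMap.range (L.latticeHom b hNb)) =
        Submodule.Quotient.mk y → e (-L.form x w) = e (-L.form y w) := fun x y hxy => by
    obtain ⟨m, hm⟩ := (Submodule.Quotient.eq _).1 hxy
    obtain ⟨k, hk⟩ := hw m
    rw [hm, Submodule.coe_sub, map_sub, LinearMap.sub_apply] at hk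
    rw [show -L.form x w = -L.form y w + (-k : ℤ) by push_cast; rw [← hk]; ring, e_add_int]
  have hout : ∀ u : L.carrier ⧸ LinearMap.range (L.latticeHom b hNb),
      (Submodule.Quotient.mk (Quotient.out u) : L.carrier ⧸ _) = u := fun u => Quotient.out_eq u
  split_ifs with hd
  · have : ∀ u : L.carrier ⧸ LinearMap.range (L.latticeHom b hNb),
        e (-L.form (Quotient.out u : L.carrier) w) = 1 := fun u => by
      obtain ⟨k, hk⟩ := L.mem_dual.1 hd _ (Quotient.out u).2
      rw [e_eq_one_iff]
      exact ⟨-k, by rw [L.symm, hk]; push_cast; rfl⟩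
    rw [Finset.sum_congr rfl fun u _ => this u]
    simp
  · have : ∃ z : L.carrier, e (-L.form z w) ≠ 1 := by
      by_contra! h
      refine hd (L.mem_dual.2 fun y hy => ?_)
      obtain ⟨k, hk⟩ := (e_eq_one_iff _).1 (h ⟨y, hy⟩)
      exact ⟨-k, by rw [L.symm]; push_cast; rw [← hk, neg_neg]⟩
    obtain ⟨z, hz⟩ := this
    set χ : (L.carrier ⧸ LinearMap.range (L.latticeHom b hNb)) → ℂ :=
      fun u => e (-L.form (Quotient.out u : L.carrier) w) with hχ
    have h : ∑ u, χ u = e (-L.form z w) * ∑ u, χ u := by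
      rw [Finset.mul_sum,
        ← Equiv.sum_comp (Equiv.addLeft (Submodule.Quotient.mk z : L.carrier ⧸ _)) χ]
      refine Finset.sum_congr rfl fun u _ => ?_
      rw [hχ, ← e_add, ← neg_add, ← LinearMap.add_apply, ← map_add, ← Submodule.coe_add]
      apply hcongr
      rw [hout, Submodule.Quotient.mk_add, hout]
      rfl
    have h2 : (1 - e (-L.form z w)) * ∑ u, χ u = 0 := by rw [sub_mul, one_mul, ← h, sub_self]
    exact (mul_eq_zero.1 h2).resolve_left (sub_ne_zero.2 hz.symm)

/-- `L` is the disjoint union of finitely many cosets of an orthogonal sublattice. -/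
theorem bijective_out_add_latticeHom {N : ℕ} (hN : 0 < N) (hNb : ∀ i, N • b i ∈ L.carrier) :
    Function.Bijective
      fun x : (L.carrier ⧸ LinearMap.range (L.latticeHom b hNb)) × (ι → ℤ) =>
        Quotient.out x.1 + L.latticeHom b hNb x.2 := by
  have hout : ∀ u : L.carrier ⧸ LinearMap.range (L.latticeHom b hNb),
      (Submodule.Quotient.mk (Quotient.out u) : L.carrier ⧸ _) = u := fun u => Quotient.out_eq u
  constructor
  · rintro ⟨u, m⟩ ⟨v, n⟩ h
    have huv : u = v := by
      have := congrArg (Submodule.Quotient.mk (p := LinearMap.range (L.latticeHom b hNb))) h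
      simpa [hout, (Submodule.Quotient.mk_eq_zero _).2 (LinearMap.mem_range_self _ _)] using this
    subst huv
    exact congrArg _ (L.latticeHom_injective b hN hNb (add_left_cancel h))
  · intro x
    have h := hout (Submodule.Quotient.mk x)
    obtain ⟨m, hm⟩ := (Submodule.Quotient.eq _).1 h.symm
    exact ⟨(Submodule.Quotient.mk x, m), by simp [hm]⟩

theorem summable_vgauss_coset (hb : ∀ i j, i ≠ j → L.form (b i) (b j) = 0)
    (p : ℍ × (ι → ℝ) × (ι → ℝ)) (c : L.dual) :
    Summable fun z : L.carrier => L.vgauss b p (c + z) := by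
  have h := (L.summable_vgauss_dual b hb p).of_norm
  have hf : Function.Injective
      fun z : L.carrier => c + (⟨z, L.carrier_le_dual z.2⟩ : L.dual) := fun z w hzw => by
    have := congrArg Subtype.val (add_left_cancel hzw)
    exact Subtype.ext this
  exact (h.comp_injective hf).congr fun z => rfl

/-- The coset `λ + L` is cut into cosets of an orthogonal sublattice, and each is inverted
separately. Summing the resulting characters over the finite quotient removes the dual vectors
outside `L'`. Only the positivity of the constant is recorded; its value comes from `theta_S`,
without computing an index or a discriminant. -/
theorem exists_theta_inversion_const (hb : ∀ i j, i ≠ j → L.form (b i) (b j) = 0) :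
    ∃ K : ℝ, 0 < K ∧ ∀ (p : ℍ × (ι → ℝ) × (ι → ℝ)) (a : L.Disc),
      L.theta b (jacobiAct ModularGroup.S p) a =
        gaussFactor (L.diag b) (Mp2Z.S.phi p.1) * (K * gaussFactor (L.diag b) (e (-1 / 8))) *
          ∑ c, L.ePair a c * L.theta b p c := by
  classical
  obtain ⟨N, hN, hNb⟩ := L.exists_smul_basis_mem b
  have := L.finite_quotient_latticeHom b hN hNb
  let _ := Fintype.ofFinite (L.carrier ⧸ LinearMap.range (L.latticeHom b hNb))
  have hN' : (0 : ℝ) < N := by exact_mod_cast hN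
  set Q := Fintype.card (L.carrier ⧸ LinearMap.range (L.latticeHom b hNb)) with hQ
  have hQ0 : 0 < Q := Fintype.card_pos
  refine ⟨Q * ∏ i, (1 / (Real.sqrt |L.diag b i| * N)), ?_, fun p a => ?_⟩
  · refine mul_pos (by exact_mod_cast hQ0) (Finset.prod_pos fun i _ => ?_)
    have := Real.sqrt_pos.2 (abs_pos.2 (L.diag_ne_zero b hb i))
    positivity
  obtain ⟨c, rfl⟩ := L.toDisc_surjective a
  obtain ⟨E, hE⟩ : ∃ E : (L.carrier ⧸ LinearMap.range (L.latticeHom b hNb)) × (ι → ℤ) ≃ L.carrier,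
      ∀ u n, E (u, n) = Quotient.out u + L.latticeHom b hNb n :=
    ⟨Equiv.ofBijective _ (L.bijective_out_add_latticeHom b hN hNb), fun _ _ => rfl⟩
  have hsum := L.summable_vgauss_coset b hb (jacobiAct ModularGroup.S p) c
  have hsumE := E.summable_iff.2 hsum
  simp only [Function.comp_def] at hsumE
  rw [theta_mk, ← E.tsum_eq, hsumE.tsum_prod' fun u => hsumE.comp_injective
    (Prod.mk_right_injective u), tsum_fintype]
  have h1 : ∀ u, ∑' n : ι → ℤ,
      L.vgauss b (jacobiAct ModularGroup.S p) ((c : V) + (E (u, n) : L.carrier))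
      = gaussFactor (L.diag b) (Mp2Z.S.phi p.1) * (∏ i, inversionConst (L.diag b i) / N) *
        ∑' n : ι → ℤ, e (-L.form (c + (Quotient.out u : L.carrier)) (L.dualVec b N n)) *
          L.vgauss b p (L.dualVec b N n) := fun u => by
    rw [← L.tsum_vgauss_latticeHom b hb hN hNb]
    refine tsum_congr fun n => ?_
    congr 1
    rw [hE, Submodule.coe_add, add_assoc]
  rw [Finset.sum_congr rfl fun u _ => h1 u, ← Finset.mul_sum]
  have hsum2 : ∀ x : V, Summable fun n : ι → ℤ =>
      e (-L.form x (L.dualVec b N n)) * L.vgauss b p (L.dualVec b N n) := fun x => by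
    refine Summable.of_norm ((L.summable_vgauss_dualVec b hb hN p).congr fun n => ?_)
    rw [norm_mul, norm_e, one_mul]
  rw [← Summable.tsum_finsetSum fun u _ => hsum2 _]
  have h2 : ∀ n : ι → ℤ, ∑ u : L.carrier ⧸ LinearMap.range (L.latticeHom b hNb),
      e (-L.form (c + (Quotient.out u : L.carrier)) (L.dualVec b N n)) *
          L.vgauss b p (L.dualVec b N n) =
      Q * if L.dualVec b N n ∈ L.dual then
        e (-L.form c (L.dualVec b N n)) * L.vgauss b p (L.dualVec b N n) else 0 := fun n => by
    simp only [map_add, LinearMap.add_apply, neg_add, e_add]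
    rw [← Finset.sum_mul, ← Finset.mul_sum, L.sum_quotient_character b hb hN hNb]
    split_ifs
    · ring
    · simp
  rw [tsum_congr h2, tsum_mul_left]
  choose n hn using L.exists_dualVec_eq b hb hN hNb
  have hinj : Function.Injective n := fun x y h => by
    apply Subtype.ext
    rw [← hn, ← hn, h]
  -- The surviving terms are those with dual vector in `L'`, so the sum may be indexed by `L'`.
  rw [← hinj.tsum_eq, L.sum_mul_theta b hb]
  · have h3 : ∀ x : L.dual, (if L.dualVec b N (n x) ∈ L.dual then
        e (-L.form c (L.dualVec b N (n x))) * L.vgauss b p (L.dualVec b N (n x)) else 0) =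
        L.ePair (L.toDisc c) (L.toDisc x) * L.vgauss b p x := fun x => by
      rw [hn, if_pos x.2, ePair_mk]
    rw [tsum_congr h3, ← mul_assoc]
    congr 1
    rw [mul_assoc]
    congr 1
    simp only [inversionConst, gaussFactor, MonoidHom.coe_mk, OneHom.coe_mk, div_div]
    rw [Finset.prod_div_distrib, Finset.prod_div_distrib]
    push_cast
    simp
    ring
  · intro m hm
    by_cases h : L.dualVec b N m ∈ L.dual
    · refine ⟨⟨_, h⟩, ?_⟩
      have h5 : L.dualVec b N (n ⟨_, h⟩) = L.dualVec b N m := hn _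
      ext i
      have h6 := congrArg (fun v => b.repr v i) h5
      simp only [repr_dualVec] at h6
      have h0 := L.form_basis_ne_zero b hb i
      have hN0 : (N : ℚ) ≠ 0 := by exact_mod_cast hN.ne'
      field_simp at h6
      exact_mod_cast h6
    · simp [h] at hm

theorem coe_S_smul_I : ModularGroup.S • UpperHalfPlane.I = UpperHalfPlane.I := by
  apply UpperHalfPlane.ext
  rw [coe_S_smul]
  simp

theorem norm_gaussFactor (D : ι → ℝ) {z : ℂ} (hz : ‖z‖ = 1) : ‖gaussFactor D z‖ = 1 := by
  simp [gaussFactor, norm_prod, hz]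

theorem ePair_sum_sum (f : L.Disc → ℂ) (a : L.Disc) :
    ∑ c, L.ePair a c * ∑ d, L.ePair c d * f d = Fintype.card L.Disc * f (-a) := by
  simp only [Finset.mul_sum]
  rw [Finset.sum_comm]
  have h : ∀ d, ∑ c, L.ePair a c * (L.ePair c d * f d) =
      (if d = -a then (Fintype.card L.Disc : ℂ) else 0) * f d := fun d => by
    have : (if d = -a then (Fintype.card L.Disc : ℂ) else 0) =
        if a + d = 0 then (Fintype.card L.Disc : ℂ) else 0 := by
      simp only [add_comm a d, eq_neg_iff_add_eq_zero]
    rw [this, ← L.sum_ePair, Finset.sum_mul]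
    refine Finset.sum_congr rfl fun c _ => ?_
    rw [ePair_add_left, L.ePair_comm c d, mul_assoc]
  simp [h]

/-- The inversion formula for theta functions. -/
theorem theta_S (hb : ∀ i j, i ≠ j → L.form (b i) (b j) = 0) (p : ℍ × (ι → ℝ) × (ι → ℝ))
    (a : L.Disc) :
    L.theta b (jacobiAct ModularGroup.S p) a =
      gaussFactor (L.diag b) (Mp2Z.S.phi p.1) *
        ((gaussFactor (L.diag b) (e (-1 / 8)) / Real.sqrt (Fintype.card L.Disc)) *
          ∑ c, L.ePair a c * L.theta b p c) := by
  obtain ⟨K, hK, h⟩ := L.exists_theta_inversion_const b hb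
  -- The point `(i, 0, 0)` is fixed by `S`. Applying the inversion formula twice there, for `λ = 0`,
  -- multiplies `θ_0` by `u² |A|`. As `θ_0` does not vanish, `u² |A| = 1`, and absolute values give
  -- `K = 1 / √|A|`.
  have hp : jacobiAct ModularGroup.S ((UpperHalfPlane.I, 0, 0) : ℍ × (ι → ℝ) × (ι → ℝ)) =
      (UpperHalfPlane.I, 0, 0) :=
    Prod.ext coe_S_smul_I (by simp [jacobiAct])
  have h1 := h (UpperHalfPlane.I, 0, 0)
  simp only [hp] at h1
  have h2 := h1 0
  rw [Finset.sum_congr rfl fun c _ => by rw [h1 c]] at h2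
  set u := gaussFactor (L.diag b) (Mp2Z.S.phi UpperHalfPlane.I) *
    (K * gaussFactor (L.diag b) (e (-1 / 8))) with hu
  have h3 : ∀ c, L.ePair 0 c * (u * ∑ d, L.ePair c d * L.theta b (UpperHalfPlane.I, 0, 0) d) =
      u * (L.ePair 0 c * ∑ d, L.ePair c d * L.theta b (UpperHalfPlane.I, 0, 0) d) :=
    fun c => by ring
  simp only [h3] at h2
  rw [← Finset.mul_sum, ePair_sum_sum, neg_zero, ← mul_assoc, ← mul_assoc] at h2
  have h4 : u * u * Fintype.card L.Disc = 1 :=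
    mul_right_cancel₀ (L.theta_I_ne_zero b hb 0 0) (by rw [one_mul]; exact h2.symm)
  have h5 : ‖u‖ = K := by
    have hS : ‖Mp2Z.S.phi UpperHalfPlane.I‖ = 1 := by
      have h0 : autFactor Mp2Z.S.mat UpperHalfPlane.I = Complex.I := by
        simp [autFactor, Mp2Z.S, ModularGroup.S]
      have h1 := congrArg norm (Mp2Z.S.sq UpperHalfPlane.I)
      rw [h0, norm_pow, Complex.norm_I] at h1
      exact (pow_eq_one_iff_of_nonneg (norm_nonneg _) two_ne_zero).1 h1
    rw [hu, norm_mul, norm_mul, norm_gaussFactor _ hS, norm_gaussFactor _ (norm_e _)]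
    simp [abs_of_pos hK]
  have h6 : K * K * Fintype.card L.Disc = 1 := by
    have := congrArg norm h4
    simpa [h5] using this
  have h7 : K = 1 / Real.sqrt (Fintype.card L.Disc) := by
    have hA : (0 : ℝ) < Fintype.card L.Disc := by exact_mod_cast Fintype.card_pos
    rw [eq_div_iff (Real.sqrt_pos.2 hA).ne', ← Real.sqrt_mul_self hK.le,
      ← Real.sqrt_mul (mul_self_nonneg K), h6, Real.sqrt_one]
  rw [h, h7]
  push_cast
  ring

theorem theta_T (hb : ∀ i j, i ≠ j → L.form (b i) (b j) = 0) (p : ℍ × (ι → ℝ) × (ι → ℝ))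
    (a : L.Disc) :
    L.theta b (jacobiAct ModularGroup.T p) a = L.eQ a * L.theta b p a := by
  rw [theta, theta, ← tsum_mul_left]
  refine tsum_congr fun x => ?_
  split_ifs with h
  -- The action of `T` is the Hecke substitution with `k = l = s = 1`, so the phase `𝒆(q(x))` is
  -- already known.
  · have h1 : jacobiAct ModularGroup.T p =
        (heckePoint 1 1 1 p.1, 1 • p.2.1 + 1 • p.2.2, 1 • p.2.2) := by
      simp only [jacobiAct, ModularGroup.T]
      refine Prod.ext ?_ ?_
      · apply UpperHalfPlane.ext
        rw [coe_heckePoint one_pos one_pos]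
        have := UpperHalfPlane.modular_T_smul p.1
        rw [ModularGroup.T] at this
        simp [this, add_comm]
      · simp
    have h2 := L.vgauss_hecke b hb 1 (k := 1) (l := 1) rfl 1 p x
    rw [← h1, one_smul] at h2
    rw [h2, ← h, eQ_mk]
    simp [q, rescale, vgauss]
  · simp

end Inversion

end EvenLattice

/-! ### Generators of the metaplectic group -/

/-- A continuous square root of `1` on the connected upper half-plane is constant. -/
theorem Mp2Z.phi_eq_one_or_neg_one {g : Mp2Z} (hg : g.mat = 1) :
    (∀ τ, g.phi τ = 1) ∨ ∀ τ, g.phi τ = -1 := by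
  have hc : ContinuousOn g.phi Set.univ := g.holo.continuous.continuousOn
  have hsq : Set.EqOn (g.phi ^ 2) 1 Set.univ := fun τ _ => by
    simp [g.sq, hg, autFactor]
  rcases isPreconnected_univ.eq_one_or_eq_neg_one_of_sq_eq hc hsq with h | h
  · exact Or.inl fun τ => h (Set.mem_univ τ)
  · exact Or.inr fun τ => h (Set.mem_univ τ)

/-- `S` and `T` generate `SL₂(ℤ)`, and the kernel of the projection consists of `(1, ±1)`. The
nontrivial kernel element is `S⁴`: since `S²` has matrix `-1` and fixes `τ`, the `φ` of `S⁴` is the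
square of that of `S²`, which is `-1`. -/
theorem Mp2Z.closure_eq_top : Subgroup.closure {Mp2Z.T, Mp2Z.S} = ⊤ := by
  let f : Mp2Z →* SL(2, ℤ) := { toFun := Mp2Z.mat, map_one' := rfl, map_mul' := fun _ _ => rfl }
  set H := Subgroup.closure {Mp2Z.T, Mp2Z.S} with hH
  have hT : Mp2Z.T ∈ H := Subgroup.subset_closure (by simp)
  have hS : Mp2Z.S ∈ H := Subgroup.subset_closure (by simp)
  have hmap : H.map f = ⊤ := by
    rw [eq_top_iff, ← SpecialLinearGroup.SL2Z_generators, Subgroup.closure_le]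
    rintro x (rfl | rfl)
    · exact ⟨_, hS, rfl⟩
    · exact ⟨_, hT, rfl⟩
  have hker : ∀ g : Mp2Z, g.mat = 1 → g ∈ H := fun g hg => by
    rcases Mp2Z.phi_eq_one_or_neg_one hg with h | h
    · have : g = 1 := Mp2Z.ext hg (funext fun τ => by simp [h])
      rw [this]; exact one_mem _
    · have hmat : (Mp2Z.S * Mp2Z.S * (Mp2Z.S * Mp2Z.S)).mat = 1 := by
        change ModularGroup.S * ModularGroup.S * (ModularGroup.S * ModularGroup.S) = 1
        decide
      have hphi : ∀ τ, (Mp2Z.S * Mp2Z.S * (Mp2Z.S * Mp2Z.S)).phi τ = -1 := fun τ => by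
        have h1 : (Mp2Z.S * Mp2Z.S).mat • τ = τ := by
          apply UpperHalfPlane.ext
          rw [Mp2Z.mul_mat, SemigroupAction.mul_smul]
          change ((ModularGroup.S • ModularGroup.S • τ : ℍ) : ℂ) = τ
          rw [coe_S_smul, coe_S_smul]
          field_simp [τ.ne_zero]
        rw [Mp2Z.mul_phi _ (Mp2Z.S * Mp2Z.S), h1, ← pow_two, Mp2Z.sq]
        have h2 : (Mp2Z.S * Mp2Z.S).mat = -1 := by
          change ModularGroup.S * ModularGroup.S = -1
          decide
        rw [h2]
        simp [autFactor]
      have : g = Mp2Z.S * Mp2Z.S * (Mp2Z.S * Mp2Z.S) :=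
        Mp2Z.ext (hg.trans hmat.symm) (funext fun τ => by rw [h, hphi])
      rw [this]
      exact mul_mem (mul_mem hS hS) (mul_mem hS hS)
  rw [eq_top_iff]
  intro g _
  obtain ⟨h, hh, hhg⟩ : g.mat ∈ H.map f := hmap ▸ Subgroup.mem_top _
  have h1 : (g * h⁻¹).mat = 1 := by
    rw [Mp2Z.mul_mat, Mp2Z.inv_mat, show h.mat = g.mat from hhg, mul_inv_cancel]
  have := mul_mem (hker _ h1) hh
  rwa [inv_mul_cancel_right] at this

/-! ### The action on `(τ, α, β)` -/

section Action

variable {W : Type*} [NormedAddCommGroup W]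

theorem jacobiAct_one (p : ℍ × W × W) : jacobiAct 1 p = p := by
  simp [jacobiAct]

theorem jacobiAct_mul (M N : SL(2, ℤ)) (p : ℍ × W × W) :
    jacobiAct (M * N) p = jacobiAct M (jacobiAct N p) := by
  refine Prod.ext (SemigroupAction.mul_smul M N p.1) (Prod.ext ?_ ?_) <;>
  · simp only [jacobiAct, Matrix.SpecialLinearGroup.coe_mul, Matrix.mul_apply, Fin.sum_univ_two]
    module

end Action

namespace EvenLattice

variable {V : Type*} [AddCommGroup V] [Module ℚ V] (L : EvenLattice V)

/-! ### The Weil representation obtained from theta functions -/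

section Weil

variable {ι : Type*} [Fintype ι] (b : Module.Basis ι ℚ V)

theorem matrix_eq_of_theta (hb : ∀ i j, i ≠ j → L.form (b i) (b j) = 0) {κ : Type*}
    {A B : Matrix κ L.Disc ℂ}
    (h : ∀ α β, A.mulVec (L.theta b (UpperHalfPlane.I, α, β)) =
      B.mulVec (L.theta b (UpperHalfPlane.I, α, β))) : A = B := by
  ext i j
  have := L.theta_independent b hb (fun a => A i a - B i a) fun α β => by
    have := congrFun (h α β) i
    simp only [Matrix.mulVec, dotProduct] at this
    simp only [sub_mul, Finset.sum_sub_distrib, this, sub_self]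
  exact sub_eq_zero.1 (congrFun this j)

/-- The matrix `A` describes the transformation of the theta functions under `g`. -/
def ThetaTransforms (g : Mp2Z) (A : Matrix L.Disc L.Disc ℂ) : Prop :=
  ∀ p : ℍ × (ι → ℝ) × (ι → ℝ), L.theta b (jacobiAct g.mat p) =
    gaussFactor (L.diag b) (g.phi p.1) • A.mulVec (L.theta b p)

variable {L b}

theorem gaussFactor_ne_zero (D : ι → ℝ) {z : ℂ} (hz : z ≠ 0) : gaussFactor D z ≠ 0 := by
  simp [gaussFactor, Finset.prod_ne_zero_iff, hz]

theorem ThetaTransforms.unique (hb : ∀ i j, i ≠ j → L.form (b i) (b j) = 0) {g : Mp2Z}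
    {A B : Matrix L.Disc L.Disc ℂ} (hA : L.ThetaTransforms b g A)
    (hB : L.ThetaTransforms b g B) : A = B :=
  L.matrix_eq_of_theta b hb fun α β =>
    smul_right_injective _ (gaussFactor_ne_zero (L.diag b) (g.phi_ne_zero UpperHalfPlane.I))
      ((hA (UpperHalfPlane.I, α, β)).symm.trans (hB (UpperHalfPlane.I, α, β)))

theorem ThetaTransforms.one : L.ThetaTransforms b 1 1 := fun p => by
  simp [jacobiAct_one]

theorem ThetaTransforms.mul {g h : Mp2Z} {A B : Matrix L.Disc L.Disc ℂ}
    (hA : L.ThetaTransforms b g A) (hB : L.ThetaTransforms b h B) :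
    L.ThetaTransforms b (g * h) (A * B) := fun p => by
  rw [Mp2Z.mul_mat, jacobiAct_mul, hA, hB, Matrix.mulVec_smul, smul_smul, Mp2Z.mul_phi, map_mul,
    Matrix.mulVec_mulVec]
  rfl

theorem ThetaTransforms.inv {g : Mp2Z} {A B : Matrix L.Disc L.Disc ℂ}
    (hA : L.ThetaTransforms b g A) (hBA : B * A = 1) : L.ThetaTransforms b g⁻¹ B := fun p => by
  have h := hA (jacobiAct g⁻¹.mat p)
  rw [← jacobiAct_mul, ← Mp2Z.mul_mat, mul_inv_cancel, Mp2Z.one_mat, jacobiAct_one] at h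
  rw [h, Matrix.mulVec_smul, Matrix.mulVec_mulVec, hBA, Matrix.one_mulVec, smul_smul, ← map_mul]
  have : (g⁻¹).phi p.1 * g.phi (jacobiAct g⁻¹.mat p).1 = 1 := by
    rw [Mp2Z.inv_phi]
    exact inv_mul_cancel₀ (g.phi_ne_zero _)
  rw [this, map_one, one_smul]

variable (L)

/-- The matrix of `ρ_L(T)`. -/
def matT : Matrix L.Disc L.Disc ℂ := Matrix.diagonal L.eQ

/-- The matrix of `ρ_L(S)`. -/
def matS : Matrix L.Disc L.Disc ℂ :=
  (e (-((L.bPos : ℚ) - L.bNeg) / 8) / (Real.sqrt (Fintype.card L.Disc) : ℂ)) •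
    Matrix.of fun a c => L.ePair a c

theorem norm_eQ (a : L.Disc) : ‖L.eQ a‖ = 1 := by
  obtain ⟨x, rfl⟩ := L.toDisc_surjective a
  exact norm_e _

theorem matT_mem_unitary : L.matT ∈ Matrix.unitaryGroup L.Disc ℂ := by
  rw [Matrix.mem_unitaryGroup_iff, matT, Matrix.star_eq_conjTranspose,
    Matrix.diagonal_conjTranspose, Matrix.diagonal_mul_diagonal, ← Matrix.diagonal_one]
  congr 1
  ext a
  simp [Complex.mul_conj, Complex.normSq_eq_norm_sq, norm_eQ]

/-- By orthogonality of characters the pairing matrix times its adjoint is `|A|`, and the scalar in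
front has absolute value `1 / √|A|`. Unitarity supplies inverses here and allows passing to adjoints
in `heckeMatrix_intertwine`. -/
theorem matS_mem_unitary : L.matS ∈ Matrix.unitaryGroup L.Disc ℂ := by
  rw [Matrix.mem_unitaryGroup_iff, matS, Matrix.star_eq_conjTranspose,
    Matrix.conjTranspose_smul, Matrix.smul_mul, Matrix.mul_smul, smul_smul]
  have h1 : (Matrix.of fun a c => L.ePair a c) * (Matrix.of fun a c => L.ePair a c).conjTranspose
      = (Fintype.card L.Disc : ℂ) • (1 : Matrix L.Disc L.Disc ℂ) := by
    ext a c
    rw [Matrix.mul_apply]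
    simp only [Matrix.conjTranspose_apply, Matrix.of_apply, Matrix.smul_apply, Matrix.one_apply,
      RCLike.star_def, ← ePair_neg_left, ← ePair_add_left, sum_ePair, ← sub_eq_add_neg,
      sub_eq_zero]
    simp
  have hA : (0 : ℝ) < Fintype.card L.Disc := by exact_mod_cast Fintype.card_pos
  rw [h1, smul_smul, RCLike.star_def, Complex.mul_conj, Complex.normSq_eq_norm_sq, norm_div,
    norm_e, Complex.norm_real, Real.norm_of_nonneg (Real.sqrt_nonneg _), div_pow,
    Real.sq_sqrt hA.le, one_pow]
  rw [show ((1 / (Fintype.card L.Disc : ℝ) : ℝ) : ℂ) * (Fintype.card L.Disc : ℂ) = 1 by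
    rw [← Complex.ofReal_natCast, ← Complex.ofReal_mul, one_div_mul_cancel hA.ne',
      Complex.ofReal_one], one_smul]

theorem matT_mulVec_basisVec (a : L.Disc) :
    L.matT.mulVec (L.basisVec a) = L.eQ a • L.basisVec a := by
  ext c
  rw [Matrix.mulVec_single_one, matT]
  rcases eq_or_ne c a with rfl | h
  · simp
  · simp [h]

theorem matS_mulVec_basisVec (a : L.Disc) : L.matS.mulVec (L.basisVec a) =
    (e (-((L.bPos : ℚ) - L.bNeg) / 8) / (Real.sqrt (Fintype.card L.Disc) : ℂ)) •
      ∑ c, L.ePair a c • L.basisVec c := by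
  ext c
  rw [Matrix.mulVec_single_one, matS]
  simp [Finset.sum_apply, Pi.single_apply, L.ePair_comm a c]

/-- An orthogonal basis exhibiting the signature of `L`. -/
def IsSignatureBasis (b : Module.Basis (Fin L.bPos ⊕ Fin L.bNeg) ℚ V) : Prop :=
  (∀ i j, i ≠ j → L.form (b i) (b j) = 0) ∧
    (∀ i, 0 < L.form (b (Sum.inl i)) (b (Sum.inl i))) ∧
    (∀ i, L.form (b (Sum.inr i)) (b (Sum.inr i)) < 0)

variable {L}
variable {b : Module.Basis (Fin L.bPos ⊕ Fin L.bNeg) ℚ V}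

/-- This is where the signature enters: it gives the automorphy factor of weight `(b⁺ / 2, b⁻ / 2)`
and, at `𝒆(-1/8)`, the root of unity of `ρ_L(S)`. -/
theorem IsSignatureBasis.gaussFactor_eq (hb : L.IsSignatureBasis b) (z : ℂ) :
    gaussFactor (L.diag b) z = z ^ L.bPos * conj z ^ L.bNeg := by
  have h1 : ∀ i, signConj (L.diag b (Sum.inl i)) z = z := fun i =>
    signConj_of_pos (by rw [diag]; exact_mod_cast hb.2.1 i) z
  have h2 : ∀ i, signConj (L.diag b (Sum.inr i)) z = conj z := fun i =>
    signConj_of_neg (by rw [diag]; exact_mod_cast hb.2.2 i) z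
  simp [gaussFactor, h1, h2]

theorem IsSignatureBasis.gaussFactor_e (hb : L.IsSignatureBasis b) :
    gaussFactor (L.diag b) (e (-1 / 8)) = e (-((L.bPos : ℚ) - L.bNeg) / 8) := by
  rw [hb.gaussFactor_eq, ← e_neg, e, e, e, ← Complex.exp_nat_mul, ← Complex.exp_nat_mul,
    ← Complex.exp_add]
  congr 1
  push_cast
  ring

theorem IsSignatureBasis.thetaTransforms_T (hb : L.IsSignatureBasis b) :
    L.ThetaTransforms b Mp2Z.T L.matT := fun p => by
  ext a
  have := L.theta_T b hb.1 p a
  simp [Mp2Z.T, this, matT, Matrix.mulVec_diagonal]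

theorem IsSignatureBasis.thetaTransforms_S (hb : L.IsSignatureBasis b) :
    L.ThetaTransforms b Mp2Z.S L.matS := fun p => by
  ext a
  have := L.theta_S b hb.1 p a
  rw [hb.gaussFactor_e] at this
  refine this.trans ?_
  rw [matS, Matrix.smul_mulVec, Pi.smul_apply, Pi.smul_apply]
  rfl

theorem IsSignatureBasis.exists_thetaTransforms (hb : L.IsSignatureBasis b) (g : Mp2Z) :
    ∃ A ∈ Matrix.unitaryGroup L.Disc ℂ, L.ThetaTransforms b g A := by
  have hg : g ∈ Subgroup.closure {Mp2Z.T, Mp2Z.S} := by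
    rw [Mp2Z.closure_eq_top]; trivial
  induction hg using Subgroup.closure_induction with
  | mem x hx =>
    rcases hx with rfl | rfl
    · exact ⟨_, L.matT_mem_unitary, hb.thetaTransforms_T⟩
    · exact ⟨_, L.matS_mem_unitary, hb.thetaTransforms_S⟩
  | one => exact ⟨1, one_mem _, ThetaTransforms.one⟩
  | mul x y _ _ hx hy =>
    obtain ⟨A, hA, hA'⟩ := hx
    obtain ⟨B, hB, hB'⟩ := hy
    exact ⟨_, mul_mem hA hB, hA'.mul hB'⟩
  | inv x _ hx =>
    obtain ⟨A, hA, hA'⟩ := hx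
    exact ⟨_, Unitary.star_mem hA, hA'.inv (Matrix.mem_unitaryGroup_iff'.1 hA)⟩

/-- The Weil representation exists. -/
theorem IsSignatureBasis.exists_isWeilRep (hb : L.IsSignatureBasis b) : ∃ ρ, L.IsWeilRep ρ := by
  choose A hA hAt using hb.exists_thetaTransforms
  -- Uniqueness of the transformation matrix makes the chosen matrices multiplicative, so no
  -- relation between `S` and `T` has to be verified.
  let f : Mp2Z →* Matrix L.Disc L.Disc ℂ :=
    { toFun := A
      map_one' := (hAt 1).unique hb.1 ThetaTransforms.one
      map_mul' := fun g h => (hAt (g * h)).unique hb.1 ((hAt g).mul (hAt h)) }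
  refine ⟨((Matrix.toLinAlgEquiv' : Matrix L.Disc L.Disc ℂ ≃ₐ[ℂ] _) :
    Matrix L.Disc L.Disc ℂ →* _).comp f, ⟨fun a => ?_, fun a => ?_⟩⟩
  · change (A Mp2Z.T).mulVec _ = _
    rw [(hAt Mp2Z.T).unique hb.1 hb.thetaTransforms_T, matT_mulVec_basisVec]
  · change (A Mp2Z.S).mulVec _ = _
    rw [(hAt Mp2Z.S).unique hb.1 hb.thetaTransforms_S, matS_mulVec_basisVec]

variable (L)

theorem exists_isSignatureBasis : ∃ b, L.IsSignatureBasis b := L.signature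

theorem isWeilRep_weilRep : L.IsWeilRep L.weilRep := by
  obtain ⟨b, hb⟩ := L.exists_isSignatureBasis
  have h := hb.exists_isWeilRep
  rw [weilRep, dif_pos h]
  exact h.choose_spec

/-- The matrix of `ρ_L(g)`. -/
def weilMatrix (g : Mp2Z) : Matrix L.Disc L.Disc ℂ := LinearMap.toMatrix' (L.weilRep g)

theorem weilRep_apply (g : Mp2Z) (v : L.Disc → ℂ) : L.weilRep g v = (L.weilMatrix g).mulVec v := by
  rw [weilMatrix, LinearMap.toMatrix'_mulVec]

theorem weilMatrix_mul (g h : Mp2Z) :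
    L.weilMatrix (g * h) = L.weilMatrix g * L.weilMatrix h := by
  rw [weilMatrix, map_mul, LinearMap.toMatrix'_mul]; rfl

theorem weilMatrix_one : L.weilMatrix 1 = 1 := by
  rw [weilMatrix, map_one, LinearMap.toMatrix'_one]

theorem weilMatrix_T : L.weilMatrix Mp2Z.T = L.matT := by
  refine Matrix.ext_of_mulVec_single fun a => ?_
  rw [← weilRep_apply]
  exact (L.isWeilRep_weilRep.onT a).trans (L.matT_mulVec_basisVec a).symm

theorem weilMatrix_S : L.weilMatrix Mp2Z.S = L.matS := by
  refine Matrix.ext_of_mulVec_single fun a => ?_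
  rw [← weilRep_apply]
  exact (L.isWeilRep_weilRep.onS a).trans (L.matS_mulVec_basisVec a).symm

variable {L}

/-- `weilRep` is obtained by choice and known only on `S` and `T`; since these generate, the theta
functions transform under every element by its matrix. -/
theorem IsSignatureBasis.thetaTransforms_weilMatrix (hb : L.IsSignatureBasis b) (g : Mp2Z) :
    L.ThetaTransforms b g (L.weilMatrix g) := by
  have hg : g ∈ Subgroup.closure {Mp2Z.T, Mp2Z.S} := by
    rw [Mp2Z.closure_eq_top]; trivial
  induction hg using Subgroup.closure_induction with
  | mem x hx =>
    rcases hx with rfl | rfl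
    · rw [weilMatrix_T]; exact hb.thetaTransforms_T
    · rw [weilMatrix_S]; exact hb.thetaTransforms_S
  | one => rw [weilMatrix_one]; exact ThetaTransforms.one
  | mul x y _ _ hx hy => rw [weilMatrix_mul]; exact hx.mul hy
  | inv x _ hx => exact hx.inv (by rw [← weilMatrix_mul, inv_mul_cancel, weilMatrix_one])

variable (L) in
theorem weilMatrix_mem_unitary (g : Mp2Z) : L.weilMatrix g ∈ Matrix.unitaryGroup L.Disc ℂ := by
  obtain ⟨b, hb⟩ := L.exists_isSignatureBasis
  obtain ⟨A, hA, hA'⟩ := hb.exists_thetaTransforms g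
  rwa [(hb.thetaTransforms_weilMatrix g).unique hb.1 hA']

end Weil

end EvenLattice

/-! ### Representatives for integral matrices of determinant `r` -/

/-- The triples `((k, l), s)` with `k l = r` and `0 ≤ s < l`. -/
def heckeIndex (r : ℕ+) : Finset (Σ _ : ℕ × ℕ, ℕ) :=
  (r : ℕ).divisorsAntidiagonal.sigma fun p => Finset.range p.2

/-- The matrix `(k s; 0 l)`. -/
def heckeMat (x : Σ _ : ℕ × ℕ, ℕ) : Matrix (Fin 2) (Fin 2) ℤ :=
  !![(x.1.1 : ℤ), (x.2 : ℤ); 0, (x.1.2 : ℤ)]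

theorem mem_heckeIndex {r : ℕ+} {x : Σ _ : ℕ × ℕ, ℕ} :
    x ∈ heckeIndex r ↔ x.1.1 * x.1.2 = r ∧ x.2 < x.1.2 := by
  simp [heckeIndex]

theorem pos_of_mem_heckeIndex {r : ℕ+} {x : Σ _ : ℕ × ℕ, ℕ} (hx : x ∈ heckeIndex r) :
    0 < x.1.1 ∧ 0 < x.1.2 := by
  have h := (mem_heckeIndex.1 hx).1
  constructor <;> refine Nat.pos_of_ne_zero fun h0 => r.ne_zero ?_ <;> rw [← h, h0] <;> simp

/-- Hermite reduction: left multiplication by `S` and `T` brings a matrix of determinant `r` to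
upper triangular form with positive diagonal and `0 ≤ s < l`. -/
theorem exists_heckeMat_eq_of_det {r : ℕ+} (A : FixedDetMatrix (Fin 2) ℤ (r : ℕ)) :
    ∃ y ∈ heckeIndex r, ∃ γ : SL(2, ℤ), A.1 = (γ : Matrix (Fin 2) (Fin 2) ℤ) * heckeMat y := by
  have hr : ((r : ℕ) : ℤ) ≠ 0 := by exact_mod_cast r.ne_zero
  induction A using FixedDetMatrices.induction_on hr with
  | h0 A h10 h00 h01 h11 =>
    have hdet := A.2
    rw [Matrix.det_fin_two, h10, mul_zero, sub_zero] at hdet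
    have hr0 : (0 : ℤ) < (r : ℕ) := by exact_mod_cast r.pos
    have h11' : 0 < A.1 1 1 := by
      rw [← hdet] at hr0
      exact (mul_pos_iff_of_pos_left h00).1 hr0
    rw [abs_of_nonneg h01, abs_of_pos h11'] at h11
    refine ⟨⟨((A.1 0 0).toNat, (A.1 1 1).toNat), (A.1 0 1).toNat⟩, ?_, 1, ?_⟩
    · rw [mem_heckeIndex]
      constructor
      · zify
        rw [Int.toNat_of_nonneg h00.le, Int.toNat_of_nonneg h11'.le, hdet]
      · zify
        rwa [Int.toNat_of_nonneg h01, Int.toNat_of_nonneg h11'.le]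
    · ext i j
      fin_cases i <;> fin_cases j <;> simp [heckeMat, h10, h00.le, h11'.le, h01]
  | hS B hB =>
    obtain ⟨y, hy, γ, h⟩ := hB
    exact ⟨y, hy, ModularGroup.S * γ, by
      rw [FixedDetMatrices.smul_coe, h, Matrix.SpecialLinearGroup.coe_mul, mul_assoc]⟩
  | hT B hB =>
    obtain ⟨y, hy, γ, h⟩ := hB
    exact ⟨y, hy, ModularGroup.T * γ, by
      rw [FixedDetMatrices.smul_coe, h, Matrix.SpecialLinearGroup.coe_mul, mul_assoc]⟩

theorem exists_heckeMat_mul {r : ℕ+} {x : Σ _ : ℕ × ℕ, ℕ} (hx : x ∈ heckeIndex r)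
    (g : SL(2, ℤ)) : ∃ y ∈ heckeIndex r, ∃ γ : SL(2, ℤ),
      heckeMat x * (g : Matrix (Fin 2) (Fin 2) ℤ) = (γ : Matrix (Fin 2) (Fin 2) ℤ) * heckeMat y :=
  exists_heckeMat_eq_of_det ⟨heckeMat x * (g : Matrix (Fin 2) (Fin 2) ℤ), by
    rw [Matrix.det_mul, g.det_coe, mul_one, Matrix.det_fin_two, heckeMat]
    simp only [Matrix.of_apply, Matrix.cons_val', Matrix.cons_val_zero, Matrix.cons_val_one,
      Matrix.cons_val_fin_one, mul_zero, sub_zero]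
    exact_mod_cast (mem_heckeIndex.1 hx).1⟩

/-- The matrix `γ` must be upper triangular with positive upper left entry, hence unipotent; its
remaining entry shifts `s` by a multiple of `l`, which `0 ≤ s, s' < l` forces to be zero. -/
theorem eq_of_heckeMat_eq {r : ℕ+} {x y : Σ _ : ℕ × ℕ, ℕ} (hx : x ∈ heckeIndex r)
    (hy : y ∈ heckeIndex r) (γ : SL(2, ℤ))
    (h : heckeMat x = (γ : Matrix (Fin 2) (Fin 2) ℤ) * heckeMat y) : x = y := by
  obtain ⟨hx1, hx2⟩ := pos_of_mem_heckeIndex hx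
  obtain ⟨hy1, hy2⟩ := pos_of_mem_heckeIndex hy
  have hxs := (mem_heckeIndex.1 hx).2
  have hys := (mem_heckeIndex.1 hy).2
  obtain ⟨⟨k, l⟩, s⟩ := x
  obtain ⟨⟨k', l'⟩, s'⟩ := y
  dsimp only at *
  have h00 := congrFun (congrFun h 0) 0
  have h01 := congrFun (congrFun h 0) 1
  have h10 := congrFun (congrFun h 1) 0
  have h11 := congrFun (congrFun h 1) 1
  have hdet := γ.det_coe
  rw [Matrix.det_fin_two] at hdet
  simp only [heckeMat, Matrix.mul_apply, Fin.sum_univ_two, Matrix.of_apply, Matrix.cons_val',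
    Matrix.cons_val_zero, Matrix.cons_val_one, Matrix.cons_val_fin_one, mul_zero, add_zero]
    at h00 h01 h10 h11
  set a := γ.1 0 0
  set β := γ.1 0 1
  set c := γ.1 1 0
  set d := γ.1 1 1
  have hk' : (0 : ℤ) < k' := by exact_mod_cast hy1
  have hk : (0 : ℤ) < k := by exact_mod_cast hx1
  have hc : c = 0 := by
    rcases mul_eq_zero.1 h10.symm with h | h
    · exact h
    · exact absurd h hk'.ne'
  rw [hc, mul_zero, sub_zero] at hdet
  have ha0 : 0 < a := by
    rw [h00] at hk
    exact (mul_pos_iff_of_pos_right hk').1 hk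
  have ha : a = 1 := by
    rcases Int.mul_eq_one_iff_eq_one_or_neg_one.1 hdet with h | h
    · exact h.1
    · omega
  have hd : d = 1 := by rw [ha, one_mul] at hdet; exact hdet
  rw [ha, one_mul] at h00 h01
  rw [hc, hd, zero_mul, one_mul, zero_add] at h11
  have hl : l = l' := by exact_mod_cast h11
  have hkk : k = k' := by exact_mod_cast h00
  subst hl hkk
  have hβ : β = 0 := by
    have h1 : (s : ℤ) < l := by exact_mod_cast hxs
    have h2 : (s' : ℤ) < l := by exact_mod_cast hys
    have h3 : (0 : ℤ) ≤ s := by positivity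
    have h4 : (0 : ℤ) ≤ s' := by positivity
    by_contra hne
    rcases lt_or_gt_of_ne hne with h | h
    · nlinarith
    · nlinarith
  rw [hβ, zero_mul, add_zero] at h01
  have : s = s' := by exact_mod_cast h01
  rw [this]

/-- Right multiplication by `g ∈ SL₂(ℤ)` permutes the cosets of the matrices `(k s; 0 l)`. -/
theorem exists_perm_heckeIndex (r : ℕ+) (g : SL(2, ℤ)) :
    ∃ (σ : Equiv.Perm (heckeIndex r)) (γ : heckeIndex r → SL(2, ℤ)), ∀ x : heckeIndex r,
      heckeMat x * (g : Matrix (Fin 2) (Fin 2) ℤ) =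
        (γ x : Matrix (Fin 2) (Fin 2) ℤ) * heckeMat (σ x) := by
  choose f hf γ hγ using fun x : heckeIndex r => exists_heckeMat_mul x.2 g
  -- If `x` and `x'` have the same image, then `γ x (γ x')⁻¹` carries the matrix of `x'` to that of
  -- `x`; on a finite index set injectivity suffices.
  have hinj : Function.Injective fun x : heckeIndex r => (⟨f x, hf x⟩ : heckeIndex r) := by
    intro x x' h
    have h : f x = f x' := congrArg Subtype.val h
    refine Subtype.ext (eq_of_heckeMat_eq x.2 x'.2 (γ x * (γ x')⁻¹) ?_)
    have h1 : ∀ x : heckeIndex r, heckeMat x =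
        ((γ x : SL(2, ℤ)) : Matrix (Fin 2) (Fin 2) ℤ) * heckeMat (f x) *
        ((g⁻¹ : SL(2, ℤ)) : Matrix (Fin 2) (Fin 2) ℤ) := fun x => by
      rw [← hγ, mul_assoc, ← Matrix.SpecialLinearGroup.coe_mul, mul_inv_cancel,
        Matrix.SpecialLinearGroup.coe_one, mul_one]
    rw [h1 x, h1 x', h, Matrix.SpecialLinearGroup.coe_mul]
    simp only [← mul_assoc]
    rw [mul_assoc (γ x : Matrix (Fin 2) (Fin 2) ℤ) _ (γ x' : Matrix (Fin 2) (Fin 2) ℤ),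
      ← Matrix.SpecialLinearGroup.coe_mul, inv_mul_cancel, Matrix.SpecialLinearGroup.coe_one,
      mul_one]
  exact ⟨Equiv.ofBijective _ (Finite.injective_iff_bijective.1 hinj), γ, hγ⟩

/-- The substitution `(τ, α, β) ↦ ((k τ + s) / l, k α + s β, l β)`. -/
def heckeAct {W : Type*} [AddCommGroup W] (x : Σ _ : ℕ × ℕ, ℕ) (p : ℍ × W × W) : ℍ × W × W :=
  (heckePoint x.1.1 x.1.2 x.2 p.1, x.1.1 • p.2.1 + x.2 • p.2.2, x.1.2 • p.2.2)

theorem heckeMat_mul_entries {x y : Σ _ : ℕ × ℕ, ℕ} {g γ : SL(2, ℤ)}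
    (h : heckeMat x * (g : Matrix (Fin 2) (Fin 2) ℤ) =
      (γ : Matrix (Fin 2) (Fin 2) ℤ) * heckeMat y) :
    ((x.1.1 : ℤ) * g 0 0 + x.2 * g 1 0 = γ 0 0 * y.1.1 ∧
      (x.1.1 : ℤ) * g 0 1 + x.2 * g 1 1 = γ 0 0 * y.2 + γ 0 1 * y.1.2) ∧
    ((x.1.2 : ℤ) * g 1 0 = γ 1 0 * y.1.1 ∧
      (x.1.2 : ℤ) * g 1 1 = γ 1 0 * y.2 + γ 1 1 * y.1.2) := by
  have h00 := congrFun (congrFun h 0) 0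
  have h01 := congrFun (congrFun h 0) 1
  have h10 := congrFun (congrFun h 1) 0
  have h11 := congrFun (congrFun h 1) 1
  simp only [heckeMat, Matrix.mul_apply, Fin.sum_univ_two, Matrix.of_apply, Matrix.cons_val',
    Matrix.cons_val_zero, Matrix.cons_val_one, Matrix.cons_val_fin_one, mul_zero, add_zero,
    zero_mul, zero_add] at h00 h01 h10 h11
  exact ⟨⟨h00, h01⟩, h10, h11⟩

/-! ### Compatibility of the Hecke substitutions with the modular action -/

section HeckeAct

variable {r : ℕ+} {x y : Σ _ : ℕ × ℕ, ℕ} {g γ : SL(2, ℤ)}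

/-- The cocycle relation for both products: the matrix `(k s; 0 l)` has constant automorphy factor
`l`, which yields the ratio of the two values of `l`. -/
theorem autFactor_heckePoint (hy : y ∈ heckeIndex r)
    (h : heckeMat x * (g : Matrix (Fin 2) (Fin 2) ℤ) =
      (γ : Matrix (Fin 2) (Fin 2) ℤ) * heckeMat y) (τ : ℍ) :
    autFactor γ (heckePoint y.1.1 y.1.2 y.2 τ) = x.1.2 / y.1.2 * autFactor g τ := by
  obtain ⟨-, h10, h11⟩ := heckeMat_mul_entries h
  obtain ⟨hy1, hy2⟩ := pos_of_mem_heckeIndex hy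
  have hl : (y.1.2 : ℂ) ≠ 0 := by exact_mod_cast hy2.ne'
  have h10' : (x.1.2 : ℂ) * (g 1 0 : ℤ) = (γ 1 0 : ℤ) * y.1.1 := by exact_mod_cast h10
  have h11' : (x.1.2 : ℂ) * (g 1 1 : ℤ) = (γ 1 0 : ℤ) * y.2 + (γ 1 1 : ℤ) * y.1.2 := by
    exact_mod_cast h11
  rw [autFactor, autFactor, coe_heckePoint hy1 hy2]
  field_simp
  linear_combination -(τ : ℂ) * h10' - h11'

theorem heckePoint_smul (hx : x ∈ heckeIndex r) (hy : y ∈ heckeIndex r)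
    (h : heckeMat x * (g : Matrix (Fin 2) (Fin 2) ℤ) =
      (γ : Matrix (Fin 2) (Fin 2) ℤ) * heckeMat y) (τ : ℍ) :
    heckePoint x.1.1 x.1.2 x.2 (g • τ) = γ • heckePoint y.1.1 y.1.2 y.2 τ := by
  have haut := autFactor_heckePoint hy h τ
  obtain ⟨⟨h00, h01⟩, -⟩ := heckeMat_mul_entries h
  obtain ⟨hy1, hy2⟩ := pos_of_mem_heckeIndex hy
  obtain ⟨hx1, hx2⟩ := pos_of_mem_heckeIndex hx
  have hl : (y.1.2 : ℂ) ≠ 0 := by exact_mod_cast hy2.ne'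
  have hl' : (x.1.2 : ℂ) ≠ 0 := by exact_mod_cast hx2.ne'
  have h00' : (x.1.1 : ℂ) * (g 0 0 : ℤ) + x.2 * (g 1 0 : ℤ) = (γ 0 0 : ℤ) * y.1.1 := by
    exact_mod_cast h00
  have h01' : (x.1.1 : ℂ) * (g 0 1 : ℤ) + x.2 * (g 1 1 : ℤ) =
      (γ 0 0 : ℤ) * y.2 + (γ 0 1 : ℤ) * y.1.2 := by
    exact_mod_cast h01
  apply UpperHalfPlane.ext
  rw [coe_heckePoint hx1 hx2, UpperHalfPlane.coe_specialLinearGroup_apply,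
    UpperHalfPlane.coe_specialLinearGroup_apply]
  simp only [eq_intCast, Complex.ofReal_intCast]
  change _ = _ / autFactor γ (heckePoint y.1.1 y.1.2 y.2 τ)
  rw [haut, coe_heckePoint hy1 hy2]
  change ((x.1.1 : ℂ) * (_ / autFactor g τ) + _) / _ = _
  have hg := autFactor_ne_zero g τ
  field_simp
  rw [autFactor]
  linear_combination (τ : ℂ) * h00' + h01'

theorem heckeAct_jacobiAct {W : Type*} [NormedAddCommGroup W]
    (hx : x ∈ heckeIndex r) (hy : y ∈ heckeIndex r)
    (h : heckeMat x * (g : Matrix (Fin 2) (Fin 2) ℤ) =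
      (γ : Matrix (Fin 2) (Fin 2) ℤ) * heckeMat y) (p : ℍ × W × W) :
    heckeAct x (jacobiAct g p) = jacobiAct γ (heckeAct y p) := by
  refine Prod.ext (heckePoint_smul hx hy h p.1) ?_
  obtain ⟨⟨h00, h01⟩, h10, h11⟩ := heckeMat_mul_entries h
  refine Prod.ext ?_ ?_
  · simp only [heckeAct, jacobiAct, ← natCast_zsmul]
    linear_combination (norm := module) h00 • p.2.1 + h01 • p.2.2
  · simp only [heckeAct, jacobiAct, ← natCast_zsmul]
    linear_combination (norm := module) h10 • p.2.1 + h11 • p.2.2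

/-- Among the two lifts of `γ`, the one wanted has its `φ` proportional to that of `g` along the
substitution, so no sign ambiguity is left in half-integral weight. -/
theorem exists_metaplectic_lift (hy : y ∈ heckeIndex r) (g : Mp2Z)
    (h : heckeMat x * (g.mat : Matrix (Fin 2) (Fin 2) ℤ) =
      (γ : Matrix (Fin 2) (Fin 2) ℤ) * heckeMat y) :
    ∃ G : Mp2Z, G.mat = γ ∧ ∀ τ, G.phi (heckePoint y.1.1 y.1.2 y.2 τ) =
      Real.sqrt (x.1.2 / y.1.2) * g.phi τ := by
  obtain ⟨hy1, hy2⟩ := pos_of_mem_heckeIndex hy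
  have hl : (y.1.2 : ℂ) ≠ 0 := by exact_mod_cast hy2.ne'
  have hk : (y.1.1 : ℂ) ≠ 0 := by exact_mod_cast hy1.ne'
  -- The inverse of `τ ↦ (k' τ + s') / l'`, along which `g.phi` is transported.
  let ψ : ℂ → ℂ := fun z => (y.1.2 * z - y.2) / y.1.1
  have hψ : ∀ z : ℂ, 0 < z.im → 0 < (ψ z).im := fun z hz => by
    have : (ψ z).im = y.1.2 * z.im / y.1.1 := by
      simp only [ψ]
      rw [Complex.div_natCast_im]
      simp
    rw [this]
    positivity
  have hψψ : ∀ τ : ℍ, heckePoint y.1.1 y.1.2 y.2 (ofComplex (ψ τ)) = τ := fun τ => by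
    apply UpperHalfPlane.ext
    rw [coe_heckePoint hy1 hy2, ofComplex_apply_of_im_pos (hψ τ τ.im_pos)]
    simp only [ψ]
    field_simp
    ring
  refine ⟨⟨γ, fun τ => Real.sqrt (x.1.2 / y.1.2) * g.phi (ofComplex (ψ τ)), ?_, fun τ => ?_⟩,
    rfl, fun τ => ?_⟩
  · have hg := UpperHalfPlane.mdifferentiable_iff.1 g.holo
    rw [UpperHalfPlane.mdifferentiable_iff]
    have hd : DifferentiableOn ℂ ψ {z | 0 < z.im} := by
      simp only [ψ]
      fun_prop
    refine ((hg.comp hd hψ).const_mul (Real.sqrt (x.1.2 / y.1.2) : ℂ)).congr fun z hz => ?_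
    simp [ofComplex_apply_of_im_pos hz]
  · have h1 := autFactor_heckePoint hy h (ofComplex (ψ τ))
    rw [hψψ] at h1
    rw [h1, mul_pow, g.sq, ← Complex.ofReal_pow, Real.sq_sqrt (by positivity)]
    push_cast
    rfl
  · have : ψ (heckePoint y.1.1 y.1.2 y.2 τ) = τ := by
      simp only [ψ]
      rw [coe_heckePoint hy1 hy2]
      field_simp
      ring
    simp only [this, ofComplex_apply]

end HeckeAct

namespace EvenLattice

variable {V : Type*} [AddCommGroup V] [Module ℚ V] (L : EvenLattice V)

/-! ### The matrices of the Hecke operators -/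

/-- The linear map `ψ ↦ ∑_μ Δ_r(μ, k) 𝒆(-(s / k) q_r(μ)) ψ_{l μ} e_μ` as a matrix. -/
def heckeMatrix (r : ℕ+) (x : Σ _ : ℕ × ℕ, ℕ) : Matrix (L.rescale r).Disc L.Disc ℂ :=
  Matrix.of fun μ a =>
    L.heckeTerm r x.1.1 x.1.2 x.2 (L.basisVec a) ((Quotient.out μ : (L.rescale r).dual) : V)

theorem heckeTerm_out {r : ℕ+} {k l : ℕ} (hkl : k * l = r) (s : ℕ) (ψ : L.Disc → ℂ)
    (y : (L.rescale r).dual) :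
    L.heckeTerm r k l s ψ ((Quotient.out ((L.rescale r).toDisc y) : (L.rescale r).dual) : V) =
      L.heckeTerm r k l s ψ y := by
  apply heckeTerm_congr r k l s hkl
  have h : (L.rescale r).toDisc (Quotient.out ((L.rescale r).toDisc y)) = (L.rescale r).toDisc y :=
    Quotient.out_eq _
  exact ((L.rescale r).toDisc_eq_iff _ _).1 h

theorem heckeTerm_eq_sum (r : ℕ+) (k l s : ℕ) (ψ : L.Disc → ℂ) (y : V) :
    L.heckeTerm r k l s ψ y = ∑ a, L.heckeTerm r k l s (L.basisVec a) y * ψ a := by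
  unfold heckeTerm
  split_ifs with h
  · simp [Pi.single_apply]
  · simp

theorem heckeMatrix_mulVec {r : ℕ+} {x : Σ _ : ℕ × ℕ, ℕ} (hx : x ∈ heckeIndex r)
    (ψ : L.Disc → ℂ) (y : (L.rescale r).dual) :
    (L.heckeMatrix r x).mulVec ψ ((L.rescale r).toDisc y) =
      L.heckeTerm r x.1.1 x.1.2 x.2 ψ y := by
  rw [← L.heckeTerm_out (mem_heckeIndex.1 hx).1, heckeTerm_eq_sum]
  rfl

theorem heckeSum_eq (r : ℕ+) (κ : ℝ) (Ψ : ℕ → ℕ → ℕ → L.Disc → ℂ) :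
    L.heckeSum r κ Ψ = ∑ x : heckeIndex r,
      (((((r : ℕ) : ℝ) ^ (κ - 1) : ℝ) : ℂ) * (1 / (((x.1.1.2 : ℝ) ^ κ : ℝ) : ℂ))) •
        (L.heckeMatrix r x).mulVec (Ψ x.1.1.1 x.1.1.2 x.1.2) := by
  ext μ
  obtain ⟨y, rfl⟩ := (L.rescale r).toDisc_surjective μ
  rw [Finset.sum_apply]
  change _ * ∑ p ∈ (r : ℕ).divisorsAntidiagonal, (1 / ((p.2 : ℝ) ^ κ : ℝ) : ℂ) *
        ∑ s ∈ Finset.range p.2, L.heckeTerm r p.1 p.2 s (Ψ p.1 p.2 s) y = _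
  simp only [Finset.mul_sum]
  rw [Finset.sum_sigma']
  refine (Finset.sum_coe_sort (heckeIndex r) _).symm.trans (Finset.sum_congr rfl fun x _ => ?_)
  rw [Pi.smul_apply, L.heckeMatrix_mulVec x.2, smul_eq_mul, mul_assoc]

theorem rescale_orthogonal {ι : Type*} {b : ι → V}
    (hb : ∀ i j, i ≠ j → L.form (b i) (b j) = 0) (r : ℕ+) :
    ∀ i j, i ≠ j → (L.rescale r).form (b i) (b j) = 0 := fun i j hij => by
  simp [rescale, hb i j hij]

/-! ### Hecke substitutions of theta functions and the intertwining relation -/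

section ThetaHecke

variable {ι : Type*} [Fintype ι] (b : Module.Basis ι ℚ V)

/-- The map `z ↦ z / l` embeds `L'` into `L(r)'` with image `L(l)'`, which is exactly the condition
`Δ_r(μ, k) = 1`. On this image `vgauss_hecke` compares the Gaussians, and its phase is the conjugate
of the one in the Hecke matrix. -/
theorem theta_heckeAct (hb : ∀ i j, i ≠ j → L.form (b i) (b j) = 0) {r : ℕ+}
    {x : Σ _ : ℕ × ℕ, ℕ} (hx : x ∈ heckeIndex r) (p : ℍ × (ι → ℝ) × (ι → ℝ)) :
    L.theta b (heckeAct x p) =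
      (L.heckeMatrix r x).conjTranspose.mulVec ((L.rescale r).theta b p) := by
  ext a
  have hkl := (mem_heckeIndex.1 hx).1
  obtain ⟨hk, hl⟩ := pos_of_mem_heckeIndex hx
  have hl0 : (x.1.2 : ℚ) ≠ 0 := by exact_mod_cast hl.ne'
  have hmem : ∀ z : L.dual, (1 / (x.1.2 : ℚ)) • (z : V) ∈ (L.rescale r).dual := fun z => by
    rw [mem_dual]
    intro w hw
    obtain ⟨n, hn⟩ := L.mem_dual.1 z.2 w hw
    refine ⟨x.1.1 * n, ?_⟩
    simp only [rescale, LinearMap.smul_apply, map_smul, smul_eq_mul, hn, ← hkl]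
    push_cast
    field_simp
  let f : L.dual → (L.rescale r).dual := fun z => ⟨_, hmem z⟩
  have hsmul : ∀ z : V, x.1.2 • (1 / (x.1.2 : ℚ)) • z = z := fun z => by
    rw [← Nat.cast_smul_eq_nsmul ℚ, smul_smul, mul_one_div_cancel hl0, one_smul]
  have hsmul' : ∀ z : V, (1 / (x.1.2 : ℚ)) • x.1.2 • z = z := fun z => by
    rw [← Nat.cast_smul_eq_nsmul ℚ, smul_smul, one_div_mul_cancel hl0, one_smul]
  have hf : Function.Injective f := fun z w h => by
    have h : (1 / (x.1.2 : ℚ)) • (z : V) = (1 / (x.1.2 : ℚ)) • (w : V) := congrArg Subtype.val h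
    apply Subtype.ext
    rw [← hsmul z, h, hsmul]
  rw [Matrix.mulVec, dotProduct, (L.rescale r).sum_mul_theta b (L.rescale_orthogonal hb r),
    theta, ← hf.tsum_eq]
  · refine tsum_congr fun z => ?_
    have hz : ((f z : (L.rescale r).dual) : V) ∈ L.scaledDual x.1.2 := by
      rw [mem_scaledDual]
      intro w hw
      obtain ⟨n, hn⟩ := L.mem_dual.1 z.2 w hw
      refine ⟨n, ?_⟩
      rw [← hn]
      simp only [f, LinearMap.smul_apply, map_smul, smul_eq_mul]
      field_simp
    have hd : (⟨x.1.2 • ((f z : (L.rescale r).dual) : V), smul_mem_dual hz⟩ : L.dual) = z :=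
      Subtype.ext (hsmul z)
    have hv := L.vgauss_hecke b hb r hkl x.2 p ((f z : (L.rescale r).dual) : V)
    rw [show x.1.2 • ((f z : (L.rescale r).dual) : V) = z from hsmul z] at hv
    rw [Matrix.conjTranspose_apply, heckeMatrix, Matrix.of_apply, L.heckeTerm_out hkl, heckeTerm,
      dif_pos hz, hd, RCLike.star_def, map_mul, ← e_neg, neg_neg, heckeAct, hv]
    rw [basisVec, Pi.single_apply]
    split_ifs <;> simp
  · intro y hy
    rw [Function.mem_support, Matrix.conjTranspose_apply, heckeMatrix, Matrix.of_apply,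
      L.heckeTerm_out hkl, heckeTerm] at hy
    split_ifs at hy with h
    · exact ⟨⟨_, smul_mem_dual h⟩, Subtype.ext (hsmul' _)⟩
    · simp at hy

end ThetaHecke

variable {L} in
theorem IsSignatureBasis.rescale {b : Module.Basis (Fin L.bPos ⊕ Fin L.bNeg) ℚ V}
    (hb : L.IsSignatureBasis b) (r : ℕ+) : (L.rescale r).IsSignatureBasis b := by
  have hr : 0 < (((r : ℕ) : ℚ)) := by exact_mod_cast r.pos
  exact ⟨L.rescale_orthogonal hb.1 r, fun i => mul_pos hr (hb.2.1 i),
    fun i => mul_neg_of_pos_of_neg hr (hb.2.2 i)⟩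

/-- The Hecke matrices intertwine the Weil representations of `L` and `L(r)`. -/
theorem heckeMatrix_intertwine {r : ℕ+} {x y : Σ _ : ℕ × ℕ, ℕ} (hx : x ∈ heckeIndex r)
    (hy : y ∈ heckeIndex r) (g G : Mp2Z)
    (h : heckeMat x * (g.mat : Matrix (Fin 2) (Fin 2) ℤ) =
      (G.mat : Matrix (Fin 2) (Fin 2) ℤ) * heckeMat y) (σ : ℝ)
    (hG : ∀ τ, G.phi (heckePoint y.1.1 y.1.2 y.2 τ) = σ * g.phi τ) :
    L.heckeMatrix r x * L.weilMatrix G =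
      ((σ : ℂ) ^ (L.bPos + L.bNeg)) • ((L.rescale r).weilMatrix g * L.heckeMatrix r y) := by
  obtain ⟨b, hb⟩ := L.exists_isSignatureBasis
  have hb' := hb.rescale r
  -- Theta of `L` at `heckeAct x (g p)` is computed in two ways: through theta of `L(r)` at `g p`,
  -- and through `G` acting on `heckeAct y p`. The real factor `σ` comes out with exponent `b⁺ +
  -- b⁻`, and independence removes theta.
  have key : (L.heckeMatrix r x).conjTranspose * (L.rescale r).weilMatrix g =
      ((σ : ℂ) ^ (L.bPos + L.bNeg)) •
        (L.weilMatrix G * (L.heckeMatrix r y).conjTranspose) := by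
    refine (L.rescale r).matrix_eq_of_theta b hb'.1 fun α β => ?_
    set p : ℍ × (Fin L.bPos ⊕ Fin L.bNeg → ℝ) × (Fin L.bPos ⊕ Fin L.bNeg → ℝ) :=
      (UpperHalfPlane.I, α, β)
    have h1 := L.theta_heckeAct b hb.1 hx (jacobiAct g.mat p)
    have hθ : (L.rescale r).theta b (jacobiAct g.mat p) =
        gaussFactor ((L.rescale r).diag b) (g.phi p.1) •
          ((L.rescale r).weilMatrix g).mulVec ((L.rescale r).theta b p) :=
      hb'.thetaTransforms_weilMatrix g p
    have hfactor : gaussFactor ((L.rescale r).diag b) (g.phi p.1) =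
        g.phi p.1 ^ L.bPos * conj (g.phi p.1) ^ L.bNeg := hb'.gaussFactor_eq _
    rw [hθ, hfactor, heckeAct_jacobiAct hx hy h,
      hb.thetaTransforms_weilMatrix G, L.theta_heckeAct b hb.1 hy, hb.gaussFactor_eq,
      Matrix.mulVec_smul, Matrix.mulVec_mulVec, Matrix.mulVec_mulVec] at h1
    have h2 : G.phi (heckeAct y p).1 = σ * g.phi p.1 := hG p.1
    have h3 : (σ * g.phi p.1) ^ L.bPos * conj (σ * g.phi p.1) ^ L.bNeg =
        (g.phi p.1 ^ L.bPos * conj (g.phi p.1) ^ L.bNeg) * (σ : ℂ) ^ (L.bPos + L.bNeg) := by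
      rw [map_mul, Complex.conj_ofReal, mul_pow, mul_pow, pow_add]
      ring
    have h4 : g.phi p.1 ^ L.bPos * conj (g.phi p.1) ^ L.bNeg ≠ 0 :=
      mul_ne_zero (pow_ne_zero _ (g.phi_ne_zero _))
        (pow_ne_zero _ ((map_ne_zero _).2 (g.phi_ne_zero _)))
    rw [h2, h3, mul_smul] at h1
    rw [Matrix.smul_mulVec]
    exact smul_right_injective _ h4 h1.symm
  -- Taking adjoints of `key` replaces both Weil matrices by their inverses; multiplying by the
  -- matrices themselves restores the stated order.
  have hu1 := Matrix.mem_unitaryGroup_iff.1 ((L.rescale r).weilMatrix_mem_unitary g)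
  have hu2 := Matrix.mem_unitaryGroup_iff'.1 (L.weilMatrix_mem_unitary G)
  rw [Matrix.star_eq_conjTranspose] at hu1 hu2
  have key2 := congrArg Matrix.conjTranspose key
  rw [Matrix.conjTranspose_mul, Matrix.conjTranspose_smul, Matrix.conjTranspose_mul,
    Matrix.conjTranspose_conjTranspose, Matrix.conjTranspose_conjTranspose, star_pow,
    RCLike.star_def, Complex.conj_ofReal] at key2
  calc L.heckeMatrix r x * L.weilMatrix G
      = (L.rescale r).weilMatrix g * (((L.rescale r).weilMatrix g).conjTranspose *
          L.heckeMatrix r x) * L.weilMatrix G := by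
        rw [← Matrix.mul_assoc ((L.rescale r).weilMatrix g), hu1, Matrix.one_mul]
    _ = _ := by
        rw [key2, Matrix.mul_smul, Matrix.smul_mul, Matrix.mul_assoc, Matrix.mul_assoc, hu2,
          Matrix.mul_one]

/-! ### Modularity of the Hecke transforms -/

section Modularity

theorem heckeTJacobi_eq {W : Type*} [AddCommGroup W] (r : ℕ+) (m n : ℤ)
    (ψ : ℍ × W × W → L.Disc → ℂ) (p : ℍ × W × W) :
    L.heckeTJacobi r m n ψ p = ∑ x : heckeIndex r,
      (((((r : ℕ) : ℝ) ^ (L.totalWeight m n - 1) : ℝ) : ℂ) *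
        (1 / (((x.1.1.2 : ℝ) ^ (L.totalWeight m n) : ℝ) : ℂ))) •
        (L.heckeMatrix r x).mulVec (ψ (heckeAct x.1 p)) :=
  L.heckeSum_eq r _ _

variable {W : Type*} [NormedAddCommGroup W] [NormedSpace ℝ W]

/-- The weight of `ψ` contributes `√(l / l')^{m + n}` and the Weil representation `√(l / l')^{b⁺ +
b⁻}`, together `(l / l')^{w + w̄}`. This is why the exponent in the Hecke operator is shifted by
half the rank. -/
theorem scaling_identity (m n : ℤ) {l l' : ℕ} (hl : 0 < l) (hl' : 0 < l') :
    1 / (l : ℝ) ^ L.totalWeight m n * (Real.sqrt (l / l') ^ m * Real.sqrt (l / l') ^ n *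
      Real.sqrt (l / l') ^ (L.bPos + L.bNeg)) = 1 / (l' : ℝ) ^ L.totalWeight m n := by
  have h1 : (0 : ℝ) < l := by exact_mod_cast hl
  have h2 : (0 : ℝ) < l' := by exact_mod_cast hl'
  have h3 : 0 < (l / l' : ℝ) := by positivity
  have hs := Real.sqrt_pos.2 h3
  have h4 : Real.sqrt (l / l') ^ m * Real.sqrt (l / l') ^ n *
      Real.sqrt (l / l') ^ (L.bPos + L.bNeg) = (l / l' : ℝ) ^ L.totalWeight m n := by
    rw [← Real.rpow_intCast, ← Real.rpow_intCast, ← Real.rpow_natCast, ← Real.rpow_add hs,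
      ← Real.rpow_add hs, Real.sqrt_eq_rpow, ← Real.rpow_mul h3.le, totalWeight]
    congr 1
    push_cast
    ring
  rw [h4, Real.div_rpow h1.le h2.le]
  have := Real.rpow_pos_of_pos h1 (L.totalWeight m n)
  field_simp

theorem heckeTJacobi_transform (r : ℕ+) (m n : ℤ) {ψ : ℍ × W × W → L.Disc → ℂ}
    (hψ : IsVVModular L.weilRep m n ψ) (g : Mp2Z) (p : ℍ × W × W) :
    L.heckeTJacobi r m n ψ (jacobiAct g.mat p) =
      (g.phi p.1 ^ m * conj (g.phi p.1) ^ n) •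
        (L.rescale r).weilRep g (L.heckeTJacobi r m n ψ p) := by
  obtain ⟨σ, γ, hγ⟩ := exists_perm_heckeIndex r g.mat
  rw [heckeTJacobi_eq, heckeTJacobi_eq, map_sum, Finset.smul_sum]
  -- After this reindexing the summand of `x` on the left is compared with the summand of `σ x` on
  -- the right.
  conv_rhs => rw [← Equiv.sum_comp σ]
  refine Finset.sum_congr rfl fun x _ => ?_
  have hx := x.2
  have hy := (σ x).2
  obtain ⟨G, hGγ, hG⟩ := exists_metaplectic_lift hy g (hγ x)
  have hmat := hγ x
  rw [← hGγ] at hmat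
  have hG' : G.phi (heckeAct (σ x).1 p).1 = _ := hG p.1
  rw [heckeAct_jacobiAct hx hy hmat, hψ.transform, weilRep_apply, map_smul, weilRep_apply,
    Matrix.mulVec_smul, Matrix.mulVec_mulVec,
    L.heckeMatrix_intertwine hx hy g G hmat _ hG, Matrix.smul_mulVec, Matrix.mulVec_mulVec,
    smul_smul, smul_smul, smul_smul, hG']
  congr 1
  have hs := congrArg Complex.ofReal
    (L.scaling_identity m n (pos_of_mem_heckeIndex hx).2 (pos_of_mem_heckeIndex hy).2)
  push_cast at hs
  rw [map_mul, Complex.conj_ofReal, mul_zpow, mul_zpow, ← hs]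
  ring

/-- The substitution is real affine and preserves the open set `Im τ > 0`. -/
theorem IsRealAnalytic.comp_heckeAct {κ : Type*} [Fintype κ] {ψ : ℍ × W × W → κ → ℂ}
    (hψ : IsRealAnalytic ψ) {r : ℕ+} {x : Σ _ : ℕ × ℕ, ℕ} (hx : x ∈ heckeIndex r) :
    IsRealAnalytic fun p => ψ (heckeAct x p) := by
  obtain ⟨hk, hl⟩ := pos_of_mem_heckeIndex hx
  let f : ℂ × W × W → ℂ × W × W := fun p =>
    ((x.1.1 * p.1 + x.2) / x.1.2, x.1.1 • p.2.1 + x.2 • p.2.2, x.1.2 • p.2.2)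
  have hf : AnalyticOnNhd ℝ f {p | 0 < p.1.im} := fun p _ => by
    simp only [f, ← Nat.cast_smul_eq_nsmul ℝ, div_eq_mul_inv]
    refine AnalyticAt.prod (((analyticAt_const.mul analyticAt_fst).add analyticAt_const).mul
      analyticAt_const) (AnalyticAt.prod ?_ ?_)
    · exact (((ContinuousLinearMap.fst ℝ W W).comp (ContinuousLinearMap.snd ℝ ℂ (W × W))).analyticAt
        p).const_smul.add (((ContinuousLinearMap.snd ℝ W W).comp
          (ContinuousLinearMap.snd ℝ ℂ (W × W))).analyticAt p).const_smul
    · exact (((ContinuousLinearMap.snd ℝ W W).comp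
          (ContinuousLinearMap.snd ℝ ℂ (W × W))).analyticAt p).const_smul
  have hmaps : Set.MapsTo f {p | 0 < p.1.im} {p | 0 < p.1.im} := fun p hp => by
    have hp : 0 < p.1.im := hp
    have : (f p).1.im = x.1.1 * p.1.im / x.1.2 := by
      simp only [f]
      rw [Complex.div_natCast_im]
      simp
    change 0 < (f p).1.im
    rw [this]
    positivity
  refine (AnalyticOnNhd.comp hψ hf hmaps).congr ?_ fun p hp => ?_
  · exact isOpen_lt continuous_const (Complex.continuous_im.comp continuous_fst)
  · have hp : 0 < p.1.im := hp
    simp only [Function.comp_apply, heckeAct, heckePoint, f, ofComplex_apply_of_im_pos hp]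

theorem heckeTJacobi_analytic (r : ℕ+) (m n : ℤ) {ψ : ℍ × W × W → L.Disc → ℂ}
    (hψ : IsRealAnalytic ψ) : IsRealAnalytic (L.heckeTJacobi r m n ψ) := by
  unfold IsRealAnalytic
  simp only [heckeTJacobi_eq]
  have h : ∀ x : heckeIndex r, AnalyticOnNhd ℝ (fun p : ℂ × W × W =>
      (((((r : ℕ) : ℝ) ^ (L.totalWeight m n - 1) : ℝ) : ℂ) *
        (1 / (((x.1.1.2 : ℝ) ^ (L.totalWeight m n) : ℝ) : ℂ))) •
        (L.heckeMatrix r x).mulVec (ψ (heckeAct x.1 (ofComplex p.1, p.2)))) {p | 0 < p.1.im} :=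
    fun x => by
      have h1 := IsRealAnalytic.comp_heckeAct hψ x.2
      exact ((((((r : ℕ) : ℝ) ^ (L.totalWeight m n - 1) : ℝ) : ℂ) *
        (1 / (((x.1.1.2 : ℝ) ^ (L.totalWeight m n) : ℝ) : ℂ))) •
          Matrix.mulVecLin (L.heckeMatrix r x)).toContinuousLinearMap.restrictScalars
            ℝ |>.comp_analyticOnNhd h1
  have h3 := Finset.analyticOnNhd_sum Finset.univ fun x _ => h x
  refine (congrArg (fun f => AnalyticOnNhd ℝ f _) ?_).mp h3
  ext1 p
  rw [Finset.sum_apply]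

theorem heckeTJacobi_mem (r : ℕ+) (m n : ℤ) {ψ : ℍ × W × W → L.Disc → ℂ}
    (hψ : ψ ∈ modularSpace W L.weilRep m n) :
    L.heckeTJacobi r m n ψ ∈ modularSpace W (L.rescale r).weilRep m n :=
  ⟨L.heckeTJacobi_analytic r m n hψ.analytic, L.heckeTJacobi_transform r m n hψ⟩

theorem heckeT_mem (r : ℕ+) (m n : ℤ) {ψ : ℍ → L.Disc → ℂ}
    (hψ : ψ ∈ modularSpaceTau L.weilRep m n) :
    L.heckeT r m n ψ ∈ modularSpaceTau (L.rescale r).weilRep m n := by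
  have hψ' : (fun p : ℍ × PUnit.{1} × PUnit.{1} => ψ p.1) ∈
      modularSpace PUnit.{1} L.weilRep m n := hψ
  have h := L.heckeTJacobi_mem r m n hψ'
  change (fun p : ℍ × PUnit.{1} × PUnit.{1} => L.heckeT r m n ψ p.1) ∈
      modularSpace PUnit.{1} (L.rescale r).weilRep m n
  exact h

end Modularity

end EvenLattice

end VVHecke

end

/-! ### The corollary -/

open VVHecke in
theorem corollaryc {V : Type*} [AddCommGroup V] [Module ℚ V] (L : EvenLattice V) (r : ℕ+)
    {W : Type*} [NormedAddCommGroup W] [NormedSpace ℝ W] :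
    (∀ (m n : ℤ), ∀ ψ ∈ modularSpaceTau L.weilRep m n,
      L.heckeT r m n ψ ∈ modularSpaceTau (L.rescale r).weilRep m n) ∧
    (∀ (m n : ℤ), ∀ ψ ∈ modularSpace W L.weilRep m n,
      L.heckeTJacobi r m n ψ ∈ modularSpace W (L.rescale r).weilRep m n) ∧
    (∀ ℓ : ℕ, L.bPos = 1 → L.bNeg + 1 = ℓ →
      ∀ ψ ∈ modularSpaceTau L.weilRep (-2 - ℓ) 0,
        (fun τ δ => L.boundStateZ r ψ δ τ) ∈
          modularSpaceTau (L.rescale r).weilRep (-2 - ℓ) 0) := by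
  refine ⟨fun m n ψ hψ => L.heckeT_mem r m n hψ, fun m n ψ hψ => L.heckeTJacobi_mem r m n hψ,
    fun ℓ hP hN ψ hψ => ?_⟩
  -- Here `w + w̄ = (-1 - ℓ / 2) + ℓ / 2 = -1`, so the prefactor becomes `r^{-2}` and `l^{-(w +
  -- w̄)}` becomes `l`.
  have hw : L.totalWeight (-2 - ℓ) 0 = -1 := by
    rw [EvenLattice.totalWeight, hP, ← hN]
    push_cast
    ring
  have h := L.heckeT_mem r _ _ hψ
  unfold EvenLattice.heckeT at h
  rw [hw] at h
  exact h
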